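/- Let $d\in\mathbb N$, let $\mathbb T^d=(\mathbb R/2\pi\mathbb Z)^d$ carry Lebesgue measure, and let $g*f(x)=(2\pi)^{-d}\int_{\mathbb T^d}g(x-y)f(y)\,dy$. All functions are complex-valued and are identified when they agree almost everywhere. For $m\ge1$ let $\mathcal V_m(t)=\frac1m\sum_{k=m}^{2m-1}\sum_{|l|\le k}e^{ilt}$ be the de la Vallée Poussin kernel, put $\mathcal A_0=\mathcal V_1$, $\mathcal A_s=\mathcal V_{2^s}-\mathcal V_{2^{s-1}}$ for $s\ge1$, and for $\mathbf s\in\mathbb N_0^d$ put $\mathcal A_{\mathbf s}(\mathbf x)=\prod_{i=1}^d\mathcal A_{s_i}(x_i)$ and $A_{\mathbf s}(f)=f*\mathcal A_{\mathbf s}$. For $r>0$ and $1\le p,q\le\infty$ the space $\mathbf B^r_{p,q}(\mathbb T^d)$ consists of all $f\in L_p(\mathbb T^d)$ with $$\|f\|_{\mathbf B^r_{p,q}}=\Big(\sum_{\mathbf s\in\mathbb N_0^d}2^{r\|\mathbf s\|_1q}\,\|A_{\mathbf s}(f)\|_p^q\Big)^{1/q}<\infty$$ (with the supremum $\sup_{\mathbf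 s}2^{r\|\mathbf s\|_1}\|A_{\mathbf s}(f)\|_p$ if $q=\infty$). For $r>0$ and $\boldsymbol\alpha\in\mathbb R^d$ let $F_{r,\boldsymbol\alpha}(\mathbf x)=\prod_{j=1}^d\big(1+2\sum_{k=1}^\infty k^{-r}\cos(kx_j-\alpha_j\pi/2)\big)$. The space $\mathbf W^r_{2,\boldsymbol\alpha}(\mathbb T^d)$ consists of all $f\in L_2(\mathbb T^d)$ of the form $f=F_{r,\boldsymbol\alpha}*\varphi$ with $\varphi\in L_2(\mathbb T^d)$, and $\|f\|_{\mathbf W^r_{2,\boldsymbol\alpha}}=\|\varphi\|_2$. We write $\mathbf W^r_2(\mathbb T^d)$ for any of these spaces (for instance with $\boldsymbol\alpha=0$). For two normed spaces $A_0,A_1$ contained in $L_1(\mathbb T^d)$, for $0<\theta<1$ and $1\le q<\infty$, let $K(t,a)=\inf\{\|a_0\|_{A_0}+t\|a_1\|_{A_1}:a=a_0+a_1\}$, and let $(A_0,A_1)_{\theta,q}$ be the real interpolation space of all $a\in A_0+A_1$ with $\|a\|_{\theta,q}=\big(\int_0^\infty(t^{-\theta}K(t,a))^q\,\frac{dt}t\big)^{1/q}<\infty$.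 **Theorem.** Let $2<p<\infty$, $0<r_0<1/2$, $r_1=r_0+1/2$, $\theta=2/p$ and $r=r_0+1/p$. Then $$\big(\mathbf B^{r_0}_{\infty,\infty}(\mathbb T^d),\mathbf W^{r_1}_2(\mathbb T^d)\big)_{\theta,p}=\mathbf B^r_{p,p}(\mathbb T^d)$$ as sets, and there are constants $c,C>0$ such that $c\,\|f\|_{\mathbf B^r_{p,p}}\le\|f\|_{\theta,p}\le C\,\|f\|_{\mathbf B^r_{p,p}}$ for all $f\in\mathbf B^r_{p,p}(\mathbb T^d)$. -/

import Mathlib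

open MeasureTheory
open scoped ENNReal NNReal

noncomputable section

namespace MixedSmoothness

instance fact_two_pi_pos : Fact (0 < 2 * Real.pi) := ⟨Real.two_pi_pos⟩

/-! ## The torus -/

/-- The torus `𝕋^d = (ℝ / 2πℤ)^d`. Its measure `volume` is the Lebesgue measure of `[0,2π)^d`, of
total mass `(2π)^d`. -/
abbrev Torus (d : ℕ) : Type := Fin d → AddCircle (2 * Real.pi)

/-- `L_1(𝕋^d)`, complex-valued functions modulo equality almost everywhere. All function spaces
below are subspaces of it, and it is the common Hausdorff space of the interpolation couple. -/
abbrev L1 (d : ℕ) : Type := Lp ℂ 1 (volume : Measure (Torus d))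

/-- The periodic convolution `(g * f)(x) = (2π)^{-d} ∫_{𝕋^d} g(x - y) f(y) dy`. -/
def conv {d : ℕ} (g f : Torus d → ℂ) (x : Torus d) : ℂ :=
  ((2 * Real.pi : ℝ) ^ d)⁻¹ • ∫ y : Torus d, g (x - y) * f y

/-! ## Besov spaces of dominating mixed smoothness -/

/-- The Dirichlet kernel `D_k(t) = ∑_{|l| ≤ k} e^{ilt}`. -/
def dirichletKernel (k : ℕ) (t : AddCircle (2 * Real.pi)) : ℂ :=
  ∑ l ∈ Finset.Icc (-(k : ℤ)) (k : ℤ), fourier l t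

/-- The de la Vallée Poussin kernel `V_m(t) = (1/m) ∑_{k=m}^{2m-1} D_k(t)`, for `m ≥ 1`. -/
def vallePoussinKernel (m : ℕ) (t : AddCircle (2 * Real.pi)) : ℂ :=
  (1 / (m : ℂ)) * ∑ k ∈ Finset.Ico m (2 * m), dirichletKernel k t

/-- `𝒜_0 = V_1` and `𝒜_s = V_{2^s} - V_{2^{s-1}}` for `s ≥ 1`. -/
def blockKernel : ℕ → AddCircle (2 * Real.pi) → ℂ
  | 0, t => vallePoussinKernel 1 t
  | s + 1, t => vallePoussinKernel (2 ^ (s + 1)) t - vallePoussinKernel (2 ^ s) t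

/-- The tensor product kernel `𝒜_s(x) = ∏_i 𝒜_{s_i}(x_i)`. -/
def blockKernelMulti {d : ℕ} (s : Fin d → ℕ) (x : Torus d) : ℂ :=
  ∏ i, blockKernel (s i) (x i)

/-- The dyadic building block `A_s(f) = f * 𝒜_s`. -/
def block {d : ℕ} (s : Fin d → ℕ) (f : Torus d → ℂ) : Torus d → ℂ :=
  conv (blockKernelMulti s) f

/-- `(∑_{s ∈ ℕ₀^d} 2^{r |s|_1 q} ‖A_s(f)‖_p^q)^{1/q}`, and for `q = ∞` the supremum
`sup_s 2^{r |s|_1} ‖A_s(f)‖_p`; here `1 ≤ p, q ≤ ∞`. -/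
def blockNorm {d : ℕ} (r : ℝ) (p q : ℝ≥0∞) (f : Torus d → ℂ) : ℝ≥0∞ :=
  if q = ∞ then
    ⨆ s : Fin d → ℕ,
      ENNReal.ofReal (2 ^ (r * ((∑ i, s i : ℕ) : ℝ))) * eLpNorm (block s f) p volume
  else
    (∑' s : Fin d → ℕ,
      ENNReal.ofReal (2 ^ (r * ((∑ i, s i : ℕ) : ℝ) * q.toReal)) *
        eLpNorm (block s f) p volume ^ q.toReal) ^ (1 / q.toReal)

open Classical in
/-- The norm of `B^r_{p,q}(𝕋^d)`, `r > 0`, extended by the value `∞` to the functions that do not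
belong to the space. The space consists of the `f ∈ L_p(𝕋^d)` for which it is finite. -/
def besovNorm {d : ℕ} (r : ℝ) (p q : ℝ≥0∞) (f : L1 d) : ℝ≥0∞ :=
  if MemLp f p volume then blockNorm r p q f else ∞

/-- The space `B^r_{p,q}(𝕋^d)`, as a subset of `L_1(𝕋^d)`. -/
def besovSpace (d : ℕ) (r : ℝ) (p q : ℝ≥0∞) : Set (L1 d) :=
  {f | besovNorm r p q f < ∞}

/-! ## Sobolev spaces of dominating mixed smoothness -/

/-- The Bernoulli kernel `F_{r,a}(x) = 1 + 2 ∑_{k ≥ 1} k^{-r} cos(kx - aπ/2)`, where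
`cos(kx - aπ/2)` is written as the real part of `e^{ikx} e^{-iaπ/2}`. The series is the limit of its
partial sums (for `r ≤ 1` it does not converge absolutely; it converges at every `x ≠ 0`). -/
def bernoulliKernel (r a : ℝ) (x : AddCircle (2 * Real.pi)) : ℝ :=
  1 + 2 * ∑'[SummationFilter.conditional ℕ] k : ℕ,
    ((k : ℝ) + 1) ^ (-r) *
      (fourier ((k : ℤ) + 1) x * Complex.exp (-(Complex.I * (a * Real.pi / 2)))).re

/-- The tensor product Bernoulli kernel `F_{r,α}(x) = ∏_j F_{r,α_j}(x_j)`. -/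
def bernoulliKernelMulti {d : ℕ} (r : ℝ) (α : Fin d → ℝ) (x : Torus d) : ℂ :=
  ∏ j, (bernoulliKernel r (α j) (x j) : ℂ)

/-- The norm of `W^r_{p,α}(𝕋^d)`, `r > 0`, extended by the value `∞` to the functions that do not
belong to the space. The space consists of the `f ∈ L_p(𝕋^d)` with `f = F_{r,α} * φ` for some
`φ ∈ L_p(𝕋^d)`, and the norm of `f` is `‖φ‖_p`. As `φ` is determined by `f`, the infimum
is over at most one element; it is `∞` if there is none. -/
def sobolevNorm {d : ℕ} (r : ℝ) (α : Fin d → ℝ) (p : ℝ≥0∞) (f : L1 d) : ℝ≥0∞ :=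
  ⨅ (φ : Lp ℂ p (volume : Measure (Torus d)))
    (_ : MemLp f p volume ∧ f =ᵐ[volume] conv (bernoulliKernelMulti r α) φ),
    eLpNorm φ p volume

/-! ## Real interpolation

A normed space `A` that is contained in a vector space `E` is given here by its extended norm
`E → [0,∞]`, which is `‖a‖_A` for `a ∈ A` and `∞` for `a ∉ A`. -/

/-- Peetre's functional `K(t,a;A₀,A₁) = inf {‖a₀‖_{A₀} + t ‖a₁‖_{A₁} : a = a₀ + a₁}`, `t > 0`; it is
`∞` exactly when `a ∉ A₀ + A₁`. -/
def kFunctional {E : Type*} [AddCommGroup E] (N₀ N₁ : E → ℝ≥0∞) (t : ℝ) (a : E) : ℝ≥0∞ :=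
  ⨅ (a₀ : E) (a₁ : E) (_ : a = a₀ + a₁), N₀ a₀ + ENNReal.ofReal t * N₁ a₁

/-- The norm `(∫_0^∞ (t^{-θ} K(t,a;A₀,A₁))^q dt/t)^{1/q}` of the real interpolation space
`(A₀,A₁)_{θ,q}`, for `0 < θ < 1` and `1 ≤ q < ∞`. -/
def interpolationNorm {E : Type*} [AddCommGroup E] (N₀ N₁ : E → ℝ≥0∞) (θ q : ℝ) (a : E) : ℝ≥0∞ :=
  (∫⁻ t in Set.Ioi (0 : ℝ),
    (ENNReal.ofReal (t ^ (-θ)) * kFunctional N₀ N₁ t a) ^ q * ENNReal.ofReal t⁻¹) ^ (1 / q)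

/-- The real interpolation space `(A₀,A₁)_{θ,q}`: the elements `a ∈ A₀ + A₁` for which the
interpolation norm is finite. -/
def interpolationSpace {E : Type*} [AddCommGroup E] (N₀ N₁ : E → ℝ≥0∞) (θ q : ℝ) : Set E :=
  {a | (∃ a₀ a₁ : E, N₀ a₀ < ∞ ∧ N₁ a₁ < ∞ ∧ a = a₀ + a₁) ∧ interpolationNorm N₀ N₁ θ q a < ∞}

end MixedSmoothness

end

noncomputable section

namespace MixedSmoothness

variable {d : ℕ}

/-! ## Characters and Fourier coefficients on the torus -/

/-! The theorem is the classical identity (L_∞, L_2)_{2/p,p} = L_p on the space ℕ₀^d × 𝕋^d with the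
measure μ = ∑_s 2^{|s|_1} dx, applied to F(s,x) = 2^{r₀|s|_1} |A_s(f)(x)|. The norm of B^{r₀}_{∞,∞}
is the L_∞(μ) norm of F. Since rp = r₀p + 1, the norm of B^r_{p,p} is its L_p(μ) norm
(`blockNorm_eq`). Since 2r₁ = 2r₀ + 1, Parseval's identity makes the norm of W^{r₁}_2 comparable to
its L_2(μ) norm. The relation r₁ = r₀ + 1/2 is what gives all three spaces the same measure.

The map f ↦ F is not onto, so the two inequalities are proved by hand.

Lower estimate: if K(t,f) ≤ λ, a nearly optimal splitting f = f₀ + f₁ has the F of f₀ at most 2λ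
almost everywhere, so F > 4λ can only come from f₁. Chebyshev's inequality in L_2(μ) then gives μ(F
> 4λ) ≤ C t^{-2} (`blockDistribution_le`). Integration in λ and t turns this into a bound of ∫ F^p
dμ by the p-th power of the interpolation norm (`lintegral_rpow_mul_le_of_le_rpow_neg_two`,
`blockEnergy_le`).

Upper estimate: every block is truncated where F exceeds λ. Truncation destroys the frequency
localization, so the truncated block is smoothed by a kernel that reproduces A_s(f), and the results
are summed. The sum has norm at most Cλ in B^{r₀}_{∞,∞}, because a block of it only sees pieces with
s' ≥ s - 2 and r₀ > 0 makes their sizes a geometric series (`blockNorm_boundedPart_le`). The rest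
has squared norm at most C ∫_{F>λ} F² dμ in W^{r₁}_2, by Cauchy–Schwarz on the Fourier side
(`exists_sub_boundedPart_eq_conv`). So K(t,f) ≤ Cλ as soon as t² ∫_{F>λ} F² dμ ≤ λ²
(`kFunctional_le`), and integration over t and λ finishes (`lintegral_highEnergy`,
`lintegral_kFunctional_le`). -/

/-- The character `e_k(x) = ∏_j e^{i k_j x_j}`. -/
def character (k : Fin d → ℤ) : C(Torus d, ℂ) where
  toFun x := ∏ i, fourier (k i) (x i)
  continuous_toFun := by fun_prop

theorem character_apply (k : Fin d → ℤ) (x : Torus d) :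
    character k x = ∏ i, fourier (k i) (x i) := rfl

theorem character_neg (k : Fin d → ℤ) (x : Torus d) :
    character (-k) x = starRingEnd ℂ (character k x) := by
  simp only [character_apply, Pi.neg_apply, fourier_neg, map_prod]

theorem character_add (k l : Fin d → ℤ) (x : Torus d) :
    character (k + l) x = character k x * character l x := by
  simp only [character_apply, Pi.add_apply, fourier_add, ← Finset.prod_mul_distrib]

@[simp]
theorem character_zero (x : Torus d) : character (0 : Fin d → ℤ) x = 1 := by
  simp [character_apply]

@[simp]
theorem norm_character (k : Fin d → ℤ) (x : Torus d) : ‖character k x‖ = 1 := by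
  rw [character_apply, norm_prod]
  exact Finset.prod_eq_one fun i _ => Circle.norm_coe _

theorem character_add_apply (k : Fin d → ℤ) (x y : Torus d) :
    character k (x + y) = character k x * character k y := by
  simp only [character_apply, ← Finset.prod_mul_distrib, fourier_apply, Pi.add_apply, smul_add,
    AddCircle.toCircle_add, Circle.coe_mul]

theorem character_neg_apply (k : Fin d → ℤ) (x : Torus d) :
    character k (-x) = character (-k) x := by
  simp [character_apply, fourier_apply]

theorem character_sub_apply (k : Fin d → ℤ) (x y : Torus d) :
    character k (x - y) = character k x * character (-k) y := by
  rw [sub_eq_add_neg, character_add_apply, character_neg_apply]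

theorem character_single (z : Torus d) (i : Fin d) :
    character (Pi.single i 1) z = fourier 1 (z i) := by
  rw [character_apply, Finset.prod_eq_single i]
  · simp
  · intro j _ hj
    simp [Pi.single_eq_of_ne hj]
  · simp

theorem integral_fourier (l : ℤ) :
    ∫ t : AddCircle (2 * Real.pi), fourier l t = if l = 0 then (2 * Real.pi : ℂ) else 0 := by
  have h := fourierCoeff_fourier (T := 2 * Real.pi) l
  have h0 := congrFun h 0
  rw [fourierCoeff, AddCircle.integral_haarAddCircle] at h0
  simp only [neg_zero, fourier_zero, one_smul] at h0
  rw [inv_smul_eq_iff₀ Real.two_pi_pos.ne'] at h0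
  rw [h0]
  by_cases hl : l = 0
  · subst hl
    simp
  · simp [Ne.symm hl, hl]

theorem integral_character (k : Fin d → ℤ) :
    ∫ x : Torus d, character k x = if k = 0 then ((2 * Real.pi : ℝ) ^ d : ℂ) else 0 := by
  simp only [character_apply]
  rw [integral_fintype_prod_volume_eq_prod (f := fun i (t : AddCircle (2 * Real.pi)) =>
    (fourier (k i) t : ℂ))]
  simp only [integral_fourier]
  split_ifs with h
  · simp [h]
  · obtain ⟨i, hi⟩ := Function.ne_iff.mp h
    exact Finset.prod_eq_zero (Finset.mem_univ i) (by simpa using hi)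

/-- The Fourier coefficient `(2π)^{-d} ∫ f(y) e^{-i⟨k,y⟩} dy`. -/
def coeff (f : Torus d → ℂ) (k : Fin d → ℤ) : ℂ :=
  ((2 * Real.pi : ℝ) ^ d)⁻¹ • ∫ y : Torus d, character (-k) y * f y

theorem two_pi_pow_pos (d : ℕ) : 0 < (2 * Real.pi : ℝ) ^ d := by positivity

theorem coeff_congr_ae {f g : Torus d → ℂ} (h : f =ᵐ[volume] g) (k : Fin d → ℤ) :
    coeff f k = coeff g k := by
  unfold coeff
  congr 1
  exact integral_congr_ae (h.mono fun x hx => by simp only [hx])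

theorem conv_congr_ae (g : Torus d → ℂ) {f f' : Torus d → ℂ} (h : f =ᵐ[volume] f') :
    conv g f = conv g f' := by
  funext x
  unfold conv
  congr 1
  exact integral_congr_ae (h.mono fun x hx => by simp only [hx])

theorem integrable_character_mul {f : Torus d → ℂ} (hf : Integrable f) (k : Fin d → ℤ) :
    Integrable fun y => character k y * f y :=
  hf.bdd_mul (c := 1) (character k).continuous.aestronglyMeasurable
    (Filter.Eventually.of_forall fun x => (norm_character k x).le)

theorem coeff_character (k l : Fin d → ℤ) :
    coeff (character k) l = if k = l then 1 else 0 := by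
  simp only [coeff, ← character_add, integral_character]
  by_cases h : k = l
  · simp only [h, neg_add_cancel, if_true]
    rw [Complex.real_smul]
    have := (two_pi_pow_pos d).ne'
    rw [Complex.ofReal_inv, Complex.ofReal_pow]
    exact inv_mul_cancel₀ (by exact_mod_cast this)
  · rw [if_neg (by rwa [neg_add_eq_zero, eq_comm]), if_neg h, smul_zero]

theorem coeff_const_mul (c : ℂ) (f : Torus d → ℂ) (k : Fin d → ℤ) :
    coeff (fun x => c * f x) k = c * coeff f k := by
  simp only [coeff, mul_left_comm _ c, integral_const_mul, mul_smul_comm]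

theorem coeff_sub {f g : Torus d → ℂ} (hf : Integrable f) (hg : Integrable g) (k : Fin d → ℤ) :
    coeff (fun x => f x - g x) k = coeff f k - coeff g k := by
  simp only [coeff, mul_sub]
  rw [integral_sub (integrable_character_mul hf _) (integrable_character_mul hg _), smul_sub]

theorem coeff_finset_sum {ι : Type*} (S : Finset ι) {f : ι → Torus d → ℂ}
    (hf : ∀ i ∈ S, Integrable (f i)) (k : Fin d → ℤ) :
    coeff (fun x => ∑ i ∈ S, f i x) k = ∑ i ∈ S, coeff (f i) k := by
  simp only [coeff, Finset.mul_sum]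
  rw [integral_finsetSum _ fun i hi => integrable_character_mul (hf i hi) _, Finset.smul_sum]

theorem conv_character (k : Fin d → ℤ) (f : Torus d → ℂ) (x : Torus d) :
    conv (character k) f x = coeff f k * character k x := by
  simp only [conv, coeff, character_sub_apply, mul_assoc, integral_const_mul]
  rw [smul_mul_assoc, mul_comm (character k x)]

/-- Since e_{-k}(x) = e_{-k}(y) e_{-k}(x-y), multiplying both factors by e_{-k} multiplies their
convolution by e_{-k}; the integral of a convolution is the product of the integrals. -/
theorem coeff_conv {g f : Torus d → ℂ} (hg : Integrable g) (hf : Integrable f) (k : Fin d → ℤ) :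
    coeff (conv g f) k = coeff g k * coeff f k := by
  have h := integral_convolution (ContinuousLinearMap.mul ℝ ℂ) (μ := volume) (ν := volume)
    (integrable_character_mul hf (-k)) (integrable_character_mul hg (-k))
  have h2 : ∀ x, (convolution (fun y => character (-k) y * f y)
      (fun y => character (-k) y * g y) (ContinuousLinearMap.mul ℝ ℂ) volume) x =
      character (-k) x * ∫ y, g (x - y) * f y := by
    intro x
    rw [convolution, ← integral_const_mul]
    congr 1
    funext y
    have : character (-k) x = character (-k) y * character (-k) (x - y) := by
      rw [← character_add_apply, add_sub_cancel]
    rw [this, ContinuousLinearMap.mul_apply']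
    ring
  simp only [h2, ContinuousLinearMap.mul_apply'] at h
  simp only [coeff, conv, mul_smul_comm, integral_smul, h, smul_mul_assoc]
  rw [mul_comm (∫ y, character (-k) y * f y)]

theorem aestronglyMeasurable_conv {g f : Torus d → ℂ} (hg : Integrable g) (hf : Integrable f) :
    AEStronglyMeasurable (conv g f) volume := by
  have h := (hf.integrable_convolution (ContinuousLinearMap.mul ℝ ℂ) (μ := volume)
    hg).aestronglyMeasurable
  have : conv g f = fun x => ((2 * Real.pi : ℝ) ^ d)⁻¹ •
      (convolution f g (ContinuousLinearMap.mul ℝ ℂ) volume) x := by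
    funext x
    simp only [conv, convolution, ContinuousLinearMap.mul_apply', mul_comm]
  rw [this]
  exact h.const_smul (((2 * Real.pi : ℝ) ^ d)⁻¹)

instance isNegInvariant_volume : (volume : Measure (Torus d)).IsNegInvariant :=
  Measure.IsAddHaarMeasure.isNegInvariant_of_regular _

/-- Young's inequality for L_1 and L_∞, at every point and not only almost everywhere, so that
series of convolutions can be summed uniformly. -/
theorem norm_conv_le_of_bounded {g f : Torus d → ℂ} (hg : Integrable g) {M : ℝ}
    (hf : ∀ y, ‖f y‖ ≤ M) (x : Torus d) :
    ‖conv g f x‖ ≤ ((2 * Real.pi) ^ d)⁻¹ * (∫ y, ‖g y‖) * M := by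
  rw [conv, norm_smul, norm_inv, Real.norm_of_nonneg (two_pi_pow_pos d).le, mul_assoc]
  refine mul_le_mul_of_nonneg_left ?_ (by positivity)
  calc ‖∫ y, g (x - y) * f y‖ ≤ ∫ y, ‖g (x - y)‖ * M := by
        refine norm_integral_le_of_norm_le ((hg.comp_sub_left x).norm.mul_const M) ?_
        refine Filter.Eventually.of_forall fun y => ?_
        rw [norm_mul]
        exact mul_le_mul_of_nonneg_left (hf y) (norm_nonneg _)
    _ = (∫ y, ‖g y‖) * M := by
        rw [integral_mul_const, integral_sub_left_eq_self (fun y => ‖g y‖) volume x]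

/-! ## The Fourier basis of `L_2` -/

/-- The star subalgebra of `C(𝕋^d)` generated by the characters. -/
def characterSubalgebra (d : ℕ) : StarSubalgebra ℂ C(Torus d, ℂ) where
  toSubalgebra := Algebra.adjoin ℂ (Set.range character)
  star_mem' := by
    change Algebra.adjoin ℂ (Set.range character) ≤ star (Algebra.adjoin ℂ (Set.range character))
    refine Algebra.adjoin_le ?_
    rintro _ ⟨n, rfl⟩
    refine Algebra.subset_adjoin ⟨-n, ?_⟩
    ext1 x
    simp only [character_neg, starRingEnd_apply, ContinuousMap.star_apply]

theorem characterSubalgebra_coe :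
    (characterSubalgebra d).toSubalgebra.toSubmodule =
      Submodule.span ℂ (Set.range character) := by
  apply Algebra.adjoin_eq_span_of_subset
  refine .trans (fun x => Submonoid.closure_induction (fun _ => id) ⟨0, ?_⟩ ?_)
    Submodule.subset_span
  · ext z
    simp
  · rintro _ _ _ _ ⟨m, rfl⟩ ⟨n, rfl⟩
    refine ⟨m + n, ?_⟩
    ext z
    simp [character_add]

/-- Characters in a single coordinate suffice, because t ↦ e^{it} is injective on the circle. -/
theorem characterSubalgebra_separatesPoints :
    (characterSubalgebra d).toSubalgebra.SeparatesPoints := by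
  intro x y hxy
  obtain ⟨i, hi⟩ := Function.ne_iff.mp hxy
  refine ⟨_, ⟨character (Pi.single i 1), Algebra.subset_adjoin ⟨Pi.single i 1, rfl⟩, rfl⟩, ?_⟩
  dsimp only
  rw [character_single, character_single, fourier_one, fourier_one, Ne, Circle.coe_inj]
  contrapose hi
  simpa using AddCircle.injective_toCircle Real.two_pi_pos.ne' hi

theorem span_character_closure_eq_top :
    (Submodule.span ℂ (Set.range (character (d := d)))).topologicalClosure = ⊤ := by
  rw [← characterSubalgebra_coe]
  exact congr_arg (Subalgebra.toSubmodule <| StarSubalgebra.toSubalgebra ·)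
    (ContinuousMap.starSubalgebra_topologicalClosure_eq_top_of_separatesPoints _
      characterSubalgebra_separatesPoints)

/-- The character `e_k` normalized in `L_2`. -/
def characterLp (k : Fin d → ℤ) : Lp ℂ 2 (volume : Measure (Torus d)) :=
  ((Real.sqrt ((2 * Real.pi) ^ d))⁻¹ : ℂ) • ContinuousMap.toLp (E := ℂ) 2 volume ℂ (character k)

/-- The square root appears because `volume` has mass (2π)^d, while `coeff` divides by that mass. -/
theorem inner_characterLp (k : Fin d → ℤ) (f : Lp ℂ 2 (volume : Measure (Torus d))) :
    inner ℂ (characterLp k) f = (Real.sqrt ((2 * Real.pi) ^ d) : ℂ) * coeff f k := by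
  have h : inner ℂ (ContinuousMap.toLp (E := ℂ) 2 volume ℂ (character k)) f =
      ∫ y, character (-k) y * f y := by
    rw [L2.inner_def]
    refine integral_congr_ae ?_
    filter_upwards [ContinuousMap.coeFn_toLp (𝕜 := ℂ) (p := 2) (volume : Measure (Torus d))
      (character k)] with y hy
    rw [hy, RCLike.inner_apply, character_neg, mul_comm]
  rw [characterLp, inner_smul_left, h, coeff]
  have hs : Real.sqrt ((2 * Real.pi) ^ d) ≠ 0 := (Real.sqrt_pos.2 (two_pi_pow_pos d)).ne'
  have hm := Real.mul_self_sqrt (two_pi_pow_pos d).le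
  rw [Complex.real_smul, ← mul_assoc]
  congr 1
  rw [map_inv₀, Complex.conj_ofReal]
  nth_rewrite 3 [← hm]
  push_cast
  have hs' : (Real.sqrt ((2 * Real.pi) ^ d) : ℂ) ≠ 0 := by exact_mod_cast hs
  field_simp

theorem orthonormal_characterLp : Orthonormal ℂ (characterLp (d := d)) := by
  rw [orthonormal_iff_ite]
  intro k l
  have h : coeff (characterLp l) k = (Real.sqrt ((2 * Real.pi) ^ d) : ℂ)⁻¹ *
      coeff (character l) k := by
    rw [← coeff_const_mul]
    refine coeff_congr_ae ?_ k
    filter_upwards [Lp.coeFn_smul ((Real.sqrt ((2 * Real.pi) ^ d))⁻¹ : ℂ)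
      (ContinuousMap.toLp (E := ℂ) 2 volume ℂ (character l)),
      ContinuousMap.coeFn_toLp (𝕜 := ℂ) (p := 2) (volume : Measure (Torus d))
      (character l)] with y hy hy'
    rw [characterLp, hy, Pi.smul_apply, hy', smul_eq_mul]
  have hs : (Real.sqrt ((2 * Real.pi) ^ d) : ℂ) ≠ 0 := by
    exact_mod_cast (Real.sqrt_pos.2 (two_pi_pow_pos d)).ne'
  rw [inner_characterLp, h, coeff_character, mul_inv_cancel_left₀ hs]
  simp only [eq_comm]

theorem span_characterLp_closure_eq_top :
    (Submodule.span ℂ (Set.range (characterLp (d := d)))).topologicalClosure = ⊤ := by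
  have h : (Submodule.span ℂ (Set.range fun k : Fin d → ℤ =>
      ContinuousMap.toLp (E := ℂ) 2 volume ℂ (character k))).topologicalClosure = ⊤ := by
    simpa only [Submodule.map_span, ContinuousLinearMap.coe_coe, ← Set.range_comp,
      Function.comp_def] using
      (ContinuousMap.toLp_denseRange ℂ (volume : Measure (Torus d)) ℂ
        (p := 2) (by simp)).topologicalClosure_map_submodule span_character_closure_eq_top
  rw [eq_top_iff, ← h]
  refine Submodule.topologicalClosure_mono (Submodule.span_le.2 ?_)
  rintro _ ⟨k, rfl⟩
  have hs : (Real.sqrt ((2 * Real.pi) ^ d) : ℂ) ≠ 0 := by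
    exact_mod_cast (Real.sqrt_pos.2 (two_pi_pow_pos d)).ne'
  have := Submodule.smul_mem (Submodule.span ℂ (Set.range (characterLp (d := d))))
    (Real.sqrt ((2 * Real.pi) ^ d) : ℂ) (Submodule.subset_span ⟨k, rfl⟩)
  rwa [characterLp, smul_inv_smul₀ hs] at this

/-- The orthonormal basis of `L_2(𝕋^d)` that consists of the normalized characters. -/
def characterBasis (d : ℕ) : HilbertBasis (Fin d → ℤ) ℂ (Lp ℂ 2 (volume : Measure (Torus d))) :=
  HilbertBasis.mk orthonormal_characterLp span_characterLp_closure_eq_top.ge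

theorem characterBasis_repr (f : Lp ℂ 2 (volume : Measure (Torus d))) (k : Fin d → ℤ) :
    (characterBasis d).repr f k = (Real.sqrt ((2 * Real.pi) ^ d) : ℂ) * coeff f k := by
  rw [(characterBasis d).repr_apply_apply, characterBasis, HilbertBasis.coe_mk, inner_characterLp]

theorem lintegral_enorm_sq_Lp (f : Lp ℂ 2 (volume : Measure (Torus d))) :
    ∫⁻ x, ‖f x‖ₑ ^ 2 = ‖f‖ₑ ^ 2 := by
  have := eLpNorm_nnreal_pow_eq_lintegral (f := f) (μ := volume) (p := 2) (by simp)
  simp only [NNReal.coe_ofNat, ENNReal.rpow_ofNat, ENNReal.coe_ofNat] at this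
  rw [← this, Lp.enorm_def]

/-- Parseval's identity. -/
theorem parseval {f : Torus d → ℂ} (hf : MemLp f 2) :
    ∫⁻ x, ‖f x‖ₑ ^ 2 = ENNReal.ofReal ((2 * Real.pi) ^ d) * ∑' k, ‖coeff f k‖ₑ ^ 2 := by
  have h1 : ∫⁻ x, ‖f x‖ₑ ^ 2 = ∫⁻ x, ‖hf.toLp f x‖ₑ ^ 2 :=
    lintegral_congr_ae (hf.coeFn_toLp.mono fun x hx => by simp only [hx])
  have h2 : ∀ k, coeff f k = coeff (hf.toLp f) k := coeff_congr_ae hf.coeFn_toLp.symm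
  simp only [h1, h2]
  set g := hf.toLp f
  have h3 := lp.hasSum_norm (p := 2) (by simp) ((characterBasis d).repr g)
  simp only [ENNReal.toReal_ofNat, Real.rpow_ofNat, characterBasis_repr,
    LinearIsometryEquiv.norm_map, norm_mul, Complex.norm_real, Real.norm_of_nonneg (Real.sqrt_nonneg _)] at h3
  simp only [mul_pow (Real.sqrt _), Real.sq_sqrt (two_pi_pow_pos d).le] at h3
  have h4 := ENNReal.ofReal_tsum_of_nonneg (fun k => by positivity) h3.summable
  rw [h3.tsum_eq, ENNReal.ofReal_pow (norm_nonneg _), ofReal_norm] at h4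
  rw [lintegral_enorm_sq_Lp, h4, ← ENNReal.tsum_mul_left]
  refine tsum_congr fun k => ?_
  rw [ENNReal.ofReal_mul (two_pi_pow_pos d).le, ENNReal.ofReal_pow (norm_nonneg _), ofReal_norm]

theorem ae_eq_of_coeff_eq {f g : Torus d → ℂ} (hf : MemLp f 2) (hg : MemLp g 2)
    (h : ∀ k, coeff f k = coeff g k) : f =ᵐ[volume] g := by
  rw [← MemLp.toLp_eq_toLp_iff hf hg]
  apply (characterBasis d).repr.injective
  ext k
  rw [characterBasis_repr, characterBasis_repr, coeff_congr_ae hf.coeFn_toLp,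
    coeff_congr_ae hg.coeFn_toLp, h]

/-- The Riesz–Fischer theorem. -/
theorem exists_coeff_eq {a : (Fin d → ℤ) → ℂ} (ha : ∑' k, ‖a k‖ₑ ^ 2 ≠ ∞) :
    ∃ φ : Lp ℂ 2 (volume : Measure (Torus d)), ∀ k, coeff φ k = a k := by
  have hs : (Real.sqrt ((2 * Real.pi) ^ d) : ℂ) ≠ 0 := by
    exact_mod_cast (Real.sqrt_pos.2 (two_pi_pow_pos d)).ne'
  have hmem : Memℓp (fun k => (Real.sqrt ((2 * Real.pi) ^ d) : ℂ) * a k) 2 := by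
    have h0 : Memℓp a 2 := by
      refine memℓp_gen ?_
      have := ENNReal.summable_toReal ha
      simpa using this
    exact h0.const_mul _
  refine ⟨(characterBasis d).repr.symm ⟨_, hmem⟩, fun k => ?_⟩
  have h := characterBasis_repr ((characterBasis d).repr.symm ⟨_, hmem⟩) k
  rw [LinearIsometryEquiv.apply_symm_apply] at h
  exact (mul_left_cancel₀ hs h).symm

/-! ## De la Vallée Poussin kernels as trigonometric polynomials -/

theorem sum_Icc_neg {M : Type*} [AddCommMonoid M] (f : ℤ → M) (n : ℕ) :
    ∑ l ∈ Finset.Icc (-(n : ℤ)) n, f l =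
      f 0 + ∑ j ∈ Finset.range n, (f ((j : ℤ) + 1) + f (-((j : ℤ) + 1))) := by
  induction n with
  | zero => simp
  | succ n ih =>
    have h : Finset.Icc (-((n + 1 : ℕ) : ℤ)) ((n + 1 : ℕ) : ℤ) =
        insert ((n : ℤ) + 1) (insert (-((n : ℤ) + 1)) (Finset.Icc (-(n : ℤ)) n)) := by
      ext l
      simp only [Finset.mem_Icc, Finset.mem_insert]
      omega
    rw [h, Finset.sum_insert, Finset.sum_insert, ih, Finset.sum_range_succ]
    · abel
    · simp
    · simp only [Finset.mem_insert, Finset.mem_Icc, not_or]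
      omega

theorem dirichletKernel_eq (n : ℕ) (t : AddCircle (2 * Real.pi)) :
    dirichletKernel n t =
      1 + ∑ j ∈ Finset.range n, (fourier ((j : ℤ) + 1) t + fourier (-((j : ℤ) + 1)) t) := by
  rw [dirichletKernel, sum_Icc_neg, fourier_zero]

theorem fourier_mul_conj (k l : ℤ) (t : AddCircle (2 * Real.pi)) :
    fourier k t * starRingEnd ℂ (fourier l t) = fourier (k - l) t := by
  rw [← fourier_neg, ← fourier_add, sub_eq_add_neg]

/-- The Fejér sum is the squared modulus of an exponential sum. -/
theorem sum_dirichletKernel (n : ℕ) (t : AddCircle (2 * Real.pi)) :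
    ∑ k ∈ Finset.range n, dirichletKernel k t =
      ((‖∑ j ∈ Finset.range n, fourier (j : ℤ) t‖ ^ 2 : ℝ) : ℂ) := by
  rw [Complex.ofReal_pow, ← Complex.mul_conj']
  induction n with
  | zero => simp
  | succ n ih =>
    rw [Finset.sum_range_succ, ih, Finset.sum_range_succ, map_add, add_mul, mul_add, mul_add,
      fourier_mul_conj, sub_self, fourier_zero, map_sum,
      Finset.mul_sum _ _ (fourier (n : ℤ) t),
      Finset.sum_mul _ _ (starRingEnd ℂ (fourier (n : ℤ) t)), dirichletKernel_eq,
      Finset.sum_add_distrib]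
    simp only [fourier_mul_conj]
    have h1 : ∑ j ∈ Finset.range n, (fourier ((j : ℤ) + 1) t : ℂ) =
        ∑ j ∈ Finset.range n, fourier ((n : ℤ) - j) t := by
      rw [← Finset.sum_range_reflect]
      refine Finset.sum_congr rfl fun j hj => ?_
      have := Finset.mem_range.1 hj
      congr 2
      omega
    have h2 : ∑ j ∈ Finset.range n, (fourier (-((j : ℤ) + 1)) t : ℂ) =
        ∑ j ∈ Finset.range n, fourier ((j : ℤ) - n) t := by
      rw [← Finset.sum_range_reflect]
      refine Finset.sum_congr rfl fun j hj => ?_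
      have := Finset.mem_range.1 hj
      congr 2
      omega
    rw [h1, h2]
    ring

theorem continuous_dirichletKernel (n : ℕ) : Continuous (dirichletKernel n) :=
  continuous_finsetSum _ fun l _ => (fourier l).continuous

theorem integral_dirichletKernel (n : ℕ) :
    ∫ t, dirichletKernel n t = (2 * Real.pi : ℂ) := by
  unfold dirichletKernel
  rw [integral_finsetSum _ fun l _ =>
    (fourier l).continuous.integrable_of_hasCompactSupport (HasCompactSupport.of_compactSpace _)]
  simp only [integral_fourier]
  simp

theorem integral_norm_sq_sum_fourier (n : ℕ) :
    ∫ t : AddCircle (2 * Real.pi), ‖∑ j ∈ Finset.range n, (fourier (j : ℤ) t : ℂ)‖ ^ 2 =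
      2 * Real.pi * n := by
  have h : ∫ t, ∑ k ∈ Finset.range n, dirichletKernel k t = (2 * Real.pi * n : ℂ) := by
    rw [integral_finsetSum _ fun k _ => (continuous_dirichletKernel k).integrable_of_hasCompactSupport
      (HasCompactSupport.of_compactSpace _)]
    simp [integral_dirichletKernel, mul_comm]
  simp only [sum_dirichletKernel] at h
  rw [integral_complex_ofReal] at h
  exact_mod_cast h

/-- A difference of two Fejér sums, each of them nonnegative, so their L_1 norms are their
integrals. -/
theorem vallePoussinKernel_eq_norm_sq (m : ℕ) (t : AddCircle (2 * Real.pi)) :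
    vallePoussinKernel m t = (1 / (m : ℂ)) *
      (((‖∑ j ∈ Finset.range (2 * m), fourier (j : ℤ) t‖ ^ 2 : ℝ) : ℂ) -
        ((‖∑ j ∈ Finset.range m, fourier (j : ℤ) t‖ ^ 2 : ℝ) : ℂ)) := by
  rw [← sum_dirichletKernel, ← sum_dirichletKernel, vallePoussinKernel,
    Finset.sum_Ico_eq_sub _ (by omega)]

theorem continuous_vallePoussinKernel (m : ℕ) : Continuous (vallePoussinKernel m) :=
  continuous_const.mul (continuous_finsetSum _ fun k _ => continuous_dirichletKernel k)

/-- The two Fejér sums have integrals 2π·2m and 2π·m; division by m leaves 3·2π, uniformly in m. -/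
theorem integral_norm_vallePoussinKernel_le {m : ℕ} (hm : 0 < m) :
    ∫ t, ‖vallePoussinKernel m t‖ ≤ 3 * (2 * Real.pi) := by
  have hm' : (0 : ℝ) < m := by exact_mod_cast hm
  have hi : ∀ n : ℕ, Integrable fun t : AddCircle (2 * Real.pi) =>
      ‖∑ j ∈ Finset.range n, (fourier (j : ℤ) t : ℂ)‖ ^ 2 := fun n =>
    Continuous.integrable_of_hasCompactSupport (by fun_prop) (HasCompactSupport.of_compactSpace _)
  calc ∫ t, ‖vallePoussinKernel m t‖
      ≤ ∫ t : AddCircle (2 * Real.pi), (1 / (m : ℝ)) *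
        (‖∑ j ∈ Finset.range (2 * m), (fourier (j : ℤ) t : ℂ)‖ ^ 2 +
          ‖∑ j ∈ Finset.range m, (fourier (j : ℤ) t : ℂ)‖ ^ 2) := by
        refine integral_mono ((continuous_vallePoussinKernel m).norm.integrable_of_hasCompactSupport
          (HasCompactSupport.of_compactSpace _)) (((hi _).add (hi _)).const_mul _) fun t => ?_
        simp only
        rw [vallePoussinKernel_eq_norm_sq, norm_mul, norm_div, norm_one, Complex.norm_natCast]
        refine mul_le_mul_of_nonneg_left ((norm_sub_le _ _).trans ?_) (by positivity)
        rw [Complex.norm_real, Complex.norm_real, Real.norm_of_nonneg (by positivity),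
          Real.norm_of_nonneg (by positivity)]
    _ = 3 * (2 * Real.pi) := by
        rw [integral_const_mul, integral_add (hi _) (hi _), integral_norm_sq_sum_fourier,
          integral_norm_sq_sum_fourier]
        push_cast
        field_simp
        ring

/-- The Fourier coefficients of the de la Vallée Poussin kernel. -/
def valleeWeight (m : ℕ) (l : ℤ) : ℝ := ((min m (2 * m - l.natAbs) : ℕ) : ℝ) / m

/-- The weight of l counts the k in [m, 2m) with |l| ≤ k. The free range N allows two kernels of
different order to be subtracted term by term. -/
theorem vallePoussinKernel_eq {m N : ℕ} (hm : 0 < m) (hN : 2 * m ≤ N)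
    (t : AddCircle (2 * Real.pi)) :
    vallePoussinKernel m t =
      ∑ l ∈ Finset.Icc (-(N : ℤ)) N, (valleeWeight m l : ℂ) * fourier l t := by
  have h1 : ∀ k ∈ Finset.Ico m (2 * m), dirichletKernel k t =
      ∑ l ∈ Finset.Icc (-(N : ℤ)) N, if l.natAbs ≤ k then (fourier l t : ℂ) else 0 := by
    intro k hk
    rw [← Finset.sum_filter, dirichletKernel]
    refine Finset.sum_congr ?_ fun _ _ => rfl
    ext l
    simp only [Finset.mem_Icc, Finset.mem_filter, Finset.mem_Ico] at hk ⊢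
    omega
  rw [vallePoussinKernel, Finset.sum_congr rfl h1, Finset.sum_comm, Finset.mul_sum]
  refine Finset.sum_congr rfl fun l _ => ?_
  have h2 : (Finset.Ico m (2 * m)).filter (fun k => l.natAbs ≤ k) =
      Finset.Ico (max m l.natAbs) (2 * m) := by
    ext k
    simp only [Finset.mem_filter, Finset.mem_Ico]
    omega
  rw [← Finset.sum_filter, h2, Finset.sum_const, Nat.card_Ico, nsmul_eq_mul, valleeWeight,
    show 2 * m - max m l.natAbs = min m (2 * m - l.natAbs) by omega, Complex.ofReal_div,
    Complex.ofReal_natCast, Complex.ofReal_natCast]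
  ring

theorem valleeWeight_nonneg (m : ℕ) (l : ℤ) : 0 ≤ valleeWeight m l := by
  unfold valleeWeight
  positivity

theorem valleeWeight_le_one (m : ℕ) (l : ℤ) : valleeWeight m l ≤ 1 :=
  div_le_one_of_le₀ (by exact_mod_cast min_le_left _ _) (by positivity)

theorem valleeWeight_eq_one {m : ℕ} (hm : 0 < m) {l : ℤ} (h : l.natAbs ≤ m) :
    valleeWeight m l = 1 := by
  have hm' : (m : ℝ) ≠ 0 := by exact_mod_cast hm.ne'
  rw [valleeWeight, show min m (2 * m - l.natAbs) = m by omega, div_self hm']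

theorem valleeWeight_eq_zero {m : ℕ} {l : ℤ} (h : 2 * m ≤ l.natAbs) :
    valleeWeight m l = 0 := by
  rw [valleeWeight, show 2 * m - l.natAbs = 0 by omega]
  simp

/-- This monotonicity makes the coefficients of the blocks nonnegative, hence numbers in [0,1] that
add up to 1 over s. -/
theorem valleeWeight_le_two_mul {m : ℕ} (hm : 0 < m) (l : ℤ) :
    valleeWeight m l ≤ valleeWeight (2 * m) l := by
  unfold valleeWeight
  have hm' : (0 : ℝ) < m := by exact_mod_cast hm
  rw [div_le_div_iff₀ hm' (by positivity)]
  have h : 2 * min m (2 * m - l.natAbs) ≤ min (2 * m) (2 * (2 * m) - l.natAbs) := by omega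
  have h' : (2 : ℝ) * (min m (2 * m - l.natAbs) : ℕ) ≤
      (min (2 * m) (2 * (2 * m) - l.natAbs) : ℕ) := by exact_mod_cast h
  push_cast at h' ⊢
  nlinarith

/-- The Fourier coefficients of `𝒜_s`. -/
def blockWeight : ℕ → ℤ → ℝ
  | 0, l => valleeWeight 1 l
  | s + 1, l => valleeWeight (2 ^ (s + 1)) l - valleeWeight (2 ^ s) l

theorem blockKernel_eq (s : ℕ) (t : AddCircle (2 * Real.pi)) :
    blockKernel s t = ∑ l ∈ Finset.Icc (-((2 ^ (s + 1) : ℕ) : ℤ)) ((2 ^ (s + 1) : ℕ) : ℤ),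
      (blockWeight s l : ℂ) * fourier l t := by
  cases s with
  | zero => exact vallePoussinKernel_eq one_pos (by norm_num) t
  | succ s =>
    rw [blockKernel, vallePoussinKernel_eq (N := 2 ^ (s + 1 + 1)) (by positivity)
        (pow_succ' 2 (s + 1)).ge,
      vallePoussinKernel_eq (N := 2 ^ (s + 1 + 1)) (by positivity) (by
        have := pow_succ 2 (s + 1)
        have := pow_succ 2 s
        omega), ← Finset.sum_sub_distrib]
    refine Finset.sum_congr rfl fun l _ => ?_
    rw [blockWeight]
    push_cast
    ring

theorem blockWeight_nonneg (s : ℕ) (l : ℤ) : 0 ≤ blockWeight s l := by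
  cases s with
  | zero => exact valleeWeight_nonneg 1 l
  | succ s =>
    have := valleeWeight_le_two_mul (m := 2 ^ s) (by positivity) l
    rw [blockWeight, pow_succ']
    linarith

theorem blockWeight_le_one (s : ℕ) (l : ℤ) : blockWeight s l ≤ 1 := by
  cases s with
  | zero => exact valleeWeight_le_one 1 l
  | succ s =>
    have := valleeWeight_le_one (2 ^ (s + 1)) l
    have := valleeWeight_nonneg (2 ^ s) l
    rw [blockWeight]
    linarith

theorem natAbs_lt_of_blockWeight_ne_zero {s : ℕ} {l : ℤ} (h : blockWeight s l ≠ 0) :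
    l.natAbs < 2 ^ (s + 1) := by
  contrapose! h
  cases s with
  | zero => exact valleeWeight_eq_zero (by simpa using h)
  | succ s =>
    rw [pow_succ'] at h
    rw [blockWeight, valleeWeight_eq_zero h, valleeWeight_eq_zero (h.trans' ?_), sub_zero]
    rw [pow_succ']
    omega

/-- For s ≥ 1 both trapezoids equal 1 when |l| ≤ 2^{s-1} and cancel there. The maximum with 1 covers
the block s = 0, which contains the frequency 0. -/
theorem two_pow_le_of_blockWeight_ne_zero {s : ℕ} {l : ℤ} (h : blockWeight s l ≠ 0) :
    2 ^ s ≤ 2 * max 1 l.natAbs := by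
  cases s with
  | zero => simp only [pow_zero]; omega
  | succ s =>
    by_contra hlt
    rw [pow_succ'] at hlt
    have h2 : l.natAbs ≤ 2 ^ s := by omega
    refine h ?_
    rw [blockWeight, valleeWeight_eq_one (by positivity) h2,
      valleeWeight_eq_one (by positivity) (by rw [pow_succ']; omega), sub_self]

theorem sum_blockWeight (n : ℕ) (l : ℤ) :
    ∑ s ∈ Finset.range (n + 1), blockWeight s l = valleeWeight (2 ^ n) l := by
  induction n with
  | zero => simp [blockWeight]
  | succ n ih => rw [Finset.sum_range_succ, ih, blockWeight]; ring

theorem continuous_blockKernel (s : ℕ) : Continuous (blockKernel s) := by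
  cases s with
  | zero => exact continuous_vallePoussinKernel 1
  | succ s => exact (continuous_vallePoussinKernel _).sub (continuous_vallePoussinKernel _)

theorem integral_norm_blockKernel_le (s : ℕ) :
    ∫ t, ‖blockKernel s t‖ ≤ 6 * (2 * Real.pi) := by
  have hpi := Real.pi_pos
  cases s with
  | zero => exact (integral_norm_vallePoussinKernel_le one_pos).trans (by linarith)
  | succ s =>
    have hi : ∀ m, Integrable fun t => ‖vallePoussinKernel m t‖ := fun m =>
      (continuous_vallePoussinKernel m).norm.integrable_of_hasCompactSupport
        (HasCompactSupport.of_compactSpace _)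
    have h1 := integral_norm_vallePoussinKernel_le (m := 2 ^ (s + 1)) (by positivity)
    have h2 := integral_norm_vallePoussinKernel_le (m := 2 ^ s) (by positivity)
    calc ∫ t, ‖blockKernel (s + 1) t‖
        ≤ ∫ t, (‖vallePoussinKernel (2 ^ (s + 1)) t‖ + ‖vallePoussinKernel (2 ^ s) t‖) :=
          integral_mono ((continuous_blockKernel _).norm.integrable_of_hasCompactSupport
            (HasCompactSupport.of_compactSpace _)) ((hi _).add (hi _)) fun t => norm_sub_le _ _
      _ ≤ 6 * (2 * Real.pi) := by
          rw [integral_add (hi _) (hi _)]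
          linarith

/-! ## Tensor product kernels -/

/-- The frequencies `k` with `|k_i| ≤ N_i` for all `i`. -/
def freqBox (N : Fin d → ℕ) : Finset (Fin d → ℤ) :=
  Fintype.piFinset fun i => Finset.Icc (-(N i : ℤ)) (N i)

theorem prod_sum_fourier (N : Fin d → ℕ) (a : Fin d → ℤ → ℝ) (x : Torus d) :
    ∏ i, ∑ l ∈ Finset.Icc (-(N i : ℤ)) (N i), (a i l : ℂ) * fourier l (x i) =
      ∑ k ∈ freqBox N, ((∏ i, a i (k i) : ℝ) : ℂ) * character k x := by
  rw [Finset.prod_univ_sum]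
  refine Finset.sum_congr rfl fun k _ => ?_
  rw [Finset.prod_mul_distrib, character_apply]
  push_cast
  rfl

theorem integrable_of_continuous {f : Torus d → ℂ} (hf : Continuous f) : Integrable f :=
  hf.integrable_of_hasCompactSupport (HasCompactSupport.of_compactSpace _)

theorem conv_trigPolynomial (S : Finset (Fin d → ℤ)) (a : (Fin d → ℤ) → ℂ) {f : Torus d → ℂ}
    (hf : Integrable f) (x : Torus d) :
    conv (fun y => ∑ k ∈ S, a k * character k y) f x =
      ∑ k ∈ S, a k * coeff f k * character k x := by
  have h : ∀ k, ∫ y, character k (x - y) * f y =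
      ((2 * Real.pi : ℝ) ^ d) • (coeff f k * character k x) := by
    intro k
    rw [← conv_character, conv, smul_inv_smul₀ (two_pi_pow_pos d).ne']
  have hi : ∀ k, Integrable fun y => character k (x - y) * f y := fun k =>
    hf.bdd_mul (c := 1) (by fun_prop)
      (Filter.Eventually.of_forall fun y => (norm_character k _).le)
  simp only [conv, Finset.sum_mul, mul_assoc]
  rw [integral_finsetSum _ fun k _ => (hi k).const_mul _, Finset.smul_sum]
  refine Finset.sum_congr rfl fun k _ => ?_
  rw [integral_const_mul, h, mul_smul_comm, inv_smul_smul₀ (two_pi_pow_pos d).ne']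

theorem coeff_trigPolynomial (S : Finset (Fin d → ℤ)) (a : (Fin d → ℤ) → ℂ) (k : Fin d → ℤ) :
    coeff (fun y => ∑ l ∈ S, a l * character l y) k = if k ∈ S then a k else 0 := by
  rw [coeff_finset_sum _ fun l _ => integrable_of_continuous (by fun_prop)]
  simp only [coeff_const_mul, coeff_character, mul_ite, mul_one, mul_zero]
  rw [Finset.sum_ite_eq']

theorem integral_norm_prod_le {K : Fin d → AddCircle (2 * Real.pi) → ℂ} {M : ℝ}
    (h : ∀ i, ∫ t, ‖K i t‖ ≤ M * (2 * Real.pi)) :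
    ((2 * Real.pi) ^ d)⁻¹ * ∫ x : Torus d, ‖∏ i, K i (x i)‖ ≤ M ^ d := by
  simp only [norm_prod]
  rw [integral_fintype_prod_volume_eq_prod (f := fun i t => ‖K i t‖),
    inv_mul_le_iff₀ (two_pi_pow_pos d), ← mul_pow, mul_comm (2 * Real.pi) M]
  calc ∏ i, ∫ t, ‖K i t‖ ≤ ∏ _i : Fin d, (M * (2 * Real.pi)) :=
        Finset.prod_le_prod (fun i _ => integral_nonneg fun t => norm_nonneg _) fun i _ => h i
    _ = (M * (2 * Real.pi)) ^ d := by simp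

/-- The Fourier coefficients of `𝒜_s`, `s ∈ ℕ₀^d`. -/
def blockWeightMulti (s : Fin d → ℕ) (k : Fin d → ℤ) : ℝ := ∏ i, blockWeight (s i) (k i)

theorem blockKernelMulti_eq (s : Fin d → ℕ) :
    blockKernelMulti s = fun x => ∑ k ∈ freqBox fun i => 2 ^ (s i + 1),
      (blockWeightMulti s k : ℂ) * character k x := by
  funext x
  simp only [blockKernelMulti, blockKernel_eq]
  exact prod_sum_fourier (fun i => 2 ^ (s i + 1)) (fun i => blockWeight (s i)) x

theorem block_eq (s : Fin d → ℕ) {f : Torus d → ℂ} (hf : Integrable f) (x : Torus d) :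
    block s f x = ∑ k ∈ freqBox fun i => 2 ^ (s i + 1),
      (blockWeightMulti s k : ℂ) * coeff f k * character k x := by
  rw [block, blockKernelMulti_eq, conv_trigPolynomial _ _ hf]

theorem continuous_block (s : Fin d → ℕ) {f : Torus d → ℂ} (hf : Integrable f) :
    Continuous (block s f) := by
  rw [show block s f = _ from funext (block_eq s hf)]
  fun_prop

theorem block_add (s : Fin d → ℕ) {f g : Torus d → ℂ} (hf : Integrable f) (hg : Integrable g)
    (x : Torus d) : block s (f + g) x = block s f x + block s g x := by
  have h : ∀ k, coeff (f + g) k = coeff f k + coeff g k := fun k => by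
    simp only [coeff, Pi.add_apply, mul_add]
    rw [integral_add (integrable_character_mul hf _) (integrable_character_mul hg _), smul_add]
  rw [block_eq s hf, block_eq s hg, block_eq s (hf.add hg), ← Finset.sum_add_distrib]
  refine Finset.sum_congr rfl fun k _ => ?_
  rw [h]
  ring

theorem blockWeightMulti_nonneg (s : Fin d → ℕ) (k : Fin d → ℤ) : 0 ≤ blockWeightMulti s k :=
  Finset.prod_nonneg fun _ _ => blockWeight_nonneg _ _

theorem blockWeightMulti_le_one (s : Fin d → ℕ) (k : Fin d → ℤ) : blockWeightMulti s k ≤ 1 :=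
  Finset.prod_le_one (fun _ _ => blockWeight_nonneg _ _) fun _ _ => blockWeight_le_one _ _

theorem blockWeight_ne_zero_of_multi {s : Fin d → ℕ} {k : Fin d → ℤ}
    (h : blockWeightMulti s k ≠ 0) (i : Fin d) : blockWeight (s i) (k i) ≠ 0 :=
  Finset.prod_ne_zero_iff.1 h i (Finset.mem_univ i)

theorem coeff_block (s : Fin d → ℕ) {f : Torus d → ℂ} (hf : Integrable f) (k : Fin d → ℤ) :
    coeff (block s f) k = blockWeightMulti s k * coeff f k := by
  rw [show block s f = _ from funext (block_eq s hf), coeff_trigPolynomial]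
  split_ifs with h
  · rfl
  · have : blockWeightMulti s k = 0 := by
      by_contra h0
      refine h (Fintype.mem_piFinset.2 fun i => ?_)
      have := natAbs_lt_of_blockWeight_ne_zero (blockWeight_ne_zero_of_multi h0 i)
      simp only [Finset.mem_Icc]
      omega
    simp [this]

/-- At a fixed frequency only finitely many blocks are active, and in each coordinate the sum
telescopes to a trapezoid on its plateau. -/
theorem hasSum_blockWeightMulti (k : Fin d → ℤ) : HasSum (fun s => blockWeightMulti s k) 1 := by
  obtain ⟨n, hn⟩ : ∃ n : ℕ, ∀ i, (k i).natAbs ≤ 2 ^ n := by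
    refine ⟨∑ i, (k i).natAbs, fun i => ?_⟩
    exact (Finset.single_le_sum (f := fun i => (k i).natAbs) (fun _ _ => Nat.zero_le _)
      (Finset.mem_univ i)).trans Nat.lt_two_pow_self.le
  -- An active s_i satisfies 2^{s_i} ≤ 2 max(1,|k_i|) ≤ 2^{n+1}, so the indices up to n + 1 are
  -- enough.
  have h1 : ∑ s ∈ Fintype.piFinset (fun _ : Fin d => Finset.range (n + 2)),
      blockWeightMulti s k = 1 := by
    simp only [blockWeightMulti]
    rw [← Finset.prod_univ_sum (fun _ => Finset.range (n + 2)) (fun i s => blockWeight s (k i))]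
    refine Finset.prod_eq_one fun i _ => ?_
    rw [sum_blockWeight (n + 1)]
    exact valleeWeight_eq_one (by positivity) ((hn i).trans (by rw [pow_succ]; omega))
  rw [← h1]
  refine hasSum_sum_of_ne_finset_zero fun s hs => ?_
  by_contra h0
  refine hs (Fintype.mem_piFinset.2 fun i => ?_)
  have h2 := two_pow_le_of_blockWeight_ne_zero (blockWeight_ne_zero_of_multi h0 i)
  have h3 : 2 ^ (s i) ≤ 2 ^ (n + 1) := by
    have := hn i
    have := Nat.one_le_two_pow (n := n)
    rw [pow_succ 2 n]
    omega
  have := (Nat.pow_le_pow_iff_right (by norm_num)).1 h3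
  rw [Finset.mem_range]
  omega

/-- The tensor product of the kernels `V_{2^{s_i+1}}`, which reproduces the functions `A_s(f)`. -/
def smoothKernel (s : Fin d → ℕ) (x : Torus d) : ℂ :=
  ∏ i, vallePoussinKernel (2 ^ (s i + 1)) (x i)

/-- The Fourier coefficients of `smoothKernel s`. -/
def smoothWeight (s : Fin d → ℕ) (k : Fin d → ℤ) : ℝ := ∏ i, valleeWeight (2 ^ (s i + 1)) (k i)

theorem smoothKernel_eq (s : Fin d → ℕ) :
    smoothKernel s = fun x => ∑ k ∈ freqBox fun i => 2 ^ (s i + 2),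
      (smoothWeight s k : ℂ) * character k x := by
  funext x
  rw [smoothKernel]
  refine Eq.trans (Finset.prod_congr rfl fun i _ => ?_)
    (prod_sum_fourier (fun i => 2 ^ (s i + 2)) (fun i => valleeWeight (2 ^ (s i + 1))) x)
  exact vallePoussinKernel_eq (by positivity) (by rw [← pow_succ']) (x i)

theorem conv_smoothKernel_eq (s : Fin d → ℕ) {f : Torus d → ℂ} (hf : Integrable f) (x : Torus d) :
    conv (smoothKernel s) f x = ∑ k ∈ freqBox fun i => 2 ^ (s i + 2),
      (smoothWeight s k : ℂ) * coeff f k * character k x := by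
  rw [smoothKernel_eq, conv_trigPolynomial _ _ hf]

theorem continuous_conv_smoothKernel (s : Fin d → ℕ) {f : Torus d → ℂ} (hf : Integrable f) :
    Continuous (conv (smoothKernel s) f) := by
  rw [show conv (smoothKernel s) f = _ from funext (conv_smoothKernel_eq s hf)]
  fun_prop

theorem smoothWeight_nonneg (s : Fin d → ℕ) (k : Fin d → ℤ) : 0 ≤ smoothWeight s k :=
  Finset.prod_nonneg fun _ _ => valleeWeight_nonneg _ _

theorem smoothWeight_le_one (s : Fin d → ℕ) (k : Fin d → ℤ) : smoothWeight s k ≤ 1 :=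
  Finset.prod_le_one (fun _ _ => valleeWeight_nonneg _ _) fun _ _ => valleeWeight_le_one _ _

theorem natAbs_lt_of_smoothWeight_ne_zero {s : Fin d → ℕ} {k : Fin d → ℤ}
    (h : smoothWeight s k ≠ 0) (i : Fin d) : (k i).natAbs < 2 ^ (s i + 2) := by
  have h1 := Finset.prod_ne_zero_iff.1 h i (Finset.mem_univ i)
  contrapose! h1
  exact valleeWeight_eq_zero (by rwa [← pow_succ'])

theorem coeff_conv_smoothKernel (s : Fin d → ℕ) {f : Torus d → ℂ} (hf : Integrable f)
    (k : Fin d → ℤ) : coeff (conv (smoothKernel s) f) k = smoothWeight s k * coeff f k := by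
  rw [show conv (smoothKernel s) f = _ from funext (conv_smoothKernel_eq s hf),
    coeff_trigPolynomial]
  split_ifs with h
  · rfl
  · have : smoothWeight s k = 0 := by
      by_contra h0
      refine h (Fintype.mem_piFinset.2 fun i => ?_)
      have := natAbs_lt_of_smoothWeight_ne_zero h0 i
      simp only [Finset.mem_Icc]
      omega
    simp [this]

/-- The spectrum of A_s lies on the plateau |k_i| ≤ 2^{s_i+1} of the smoothing kernel, so smoothing
leaves A_s(f) unchanged and acts only on the truncation error. -/
theorem smoothWeight_mul_blockWeightMulti (s : Fin d → ℕ) (k : Fin d → ℤ) :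
    smoothWeight s k * blockWeightMulti s k = blockWeightMulti s k := by
  by_cases h : blockWeightMulti s k = 0
  · simp [h]
  · have : smoothWeight s k = 1 := Finset.prod_eq_one fun i _ =>
      valleeWeight_eq_one (by positivity)
        (natAbs_lt_of_blockWeight_ne_zero (blockWeight_ne_zero_of_multi h i)).le
    rw [this, one_mul]

/-- A common frequency satisfies 2^{s_i} ≤ 2 max(1,|k_i|) and |k_i| < 2^{s'_i+2}, hence 2^{s_i} <
2^{s'_i+3}. -/
theorem le_of_blockWeightMulti_mul_smoothWeight_ne_zero {s s' : Fin d → ℕ} {k : Fin d → ℤ}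
    (h : blockWeightMulti s k * smoothWeight s' k ≠ 0) (i : Fin d) : s i ≤ s' i + 2 := by
  have h1 := two_pow_le_of_blockWeight_ne_zero
    (blockWeight_ne_zero_of_multi (left_ne_zero_of_mul h) i)
  have h2 := natAbs_lt_of_smoothWeight_ne_zero (right_ne_zero_of_mul h) i
  have h3 : 2 ^ (s i) < 2 ^ (s' i + 2 + 1) := by
    have : 1 < 2 ^ (s' i + 2) := Nat.one_lt_two_pow (by omega)
    rw [pow_succ 2 (s' i + 2)]
    omega
  have := (Nat.pow_lt_pow_iff_right (by norm_num)).1 h3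
  omega

theorem norm_block_le (s : Fin d → ℕ) {f : Torus d → ℂ} {M : ℝ} (hM : 0 ≤ M)
    (hf : ∀ y, ‖f y‖ ≤ M) (x : Torus d) : ‖block s f x‖ ≤ 6 ^ d * M := by
  refine (norm_conv_le_of_bounded (integrable_of_continuous ?_) hf x).trans
    (mul_le_mul_of_nonneg_right
      (integral_norm_prod_le fun i => integral_norm_blockKernel_le (s i)) hM)
  rw [blockKernelMulti_eq]
  fun_prop

theorem norm_conv_smoothKernel_le (s : Fin d → ℕ) {f : Torus d → ℂ} {M : ℝ} (hM : 0 ≤ M)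
    (hf : ∀ y, ‖f y‖ ≤ M) (x : Torus d) : ‖conv (smoothKernel s) f x‖ ≤ 3 ^ d * M := by
  refine (norm_conv_le_of_bounded (integrable_of_continuous ?_) hf x).trans
    (mul_le_mul_of_nonneg_right
      (integral_norm_prod_le fun i => integral_norm_vallePoussinKernel_le (by positivity)) hM)
  rw [smoothKernel_eq]
  fun_prop

/-! ## The Bernoulli kernels -/

/-- The Fourier coefficients of the Bernoulli kernel. -/
def bernoulliCoeff (r a : ℝ) (l : ℤ) : ℂ :=
  if l = 0 then 1 else
    (((l.natAbs : ℝ) ^ (-r) : ℝ) : ℂ) *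
      if 0 < l then Complex.exp (-(Complex.I * (a * Real.pi / 2)))
      else starRingEnd ℂ (Complex.exp (-(Complex.I * (a * Real.pi / 2))))

theorem norm_exp_phase (a : ℝ) : ‖Complex.exp (-(Complex.I * (a * Real.pi / 2)))‖ = 1 := by
  rw [Complex.norm_exp]
  simp

theorem norm_bernoulliCoeff (r a : ℝ) (l : ℤ) :
    ‖bernoulliCoeff r a l‖ = ((max 1 l.natAbs : ℕ) : ℝ) ^ (-r) := by
  unfold bernoulliCoeff
  split_ifs with h0 h1
  · simp [h0]
  all_goals
    rw [show max 1 l.natAbs = l.natAbs by omega, norm_mul, Complex.norm_real]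
    simp only [RCLike.norm_conj, norm_exp_phase, mul_one]
    exact Real.norm_of_nonneg (by positivity)

theorem sum_bernoulliCoeff (r a : ℝ) (n : ℕ) (x : AddCircle (2 * Real.pi)) :
    ∑ l ∈ Finset.Icc (-(n : ℤ)) n, bernoulliCoeff r a l * fourier l x =
      ((1 + 2 * ∑ k ∈ Finset.range n, ((k : ℝ) + 1) ^ (-r) *
        (fourier ((k : ℤ) + 1) x * Complex.exp (-(Complex.I * (a * Real.pi / 2)))).re : ℝ) : ℂ) := by
  rw [sum_Icc_neg]
  push_cast
  rw [Finset.mul_sum]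
  congr 1
  · simp [bernoulliCoeff]
  refine Finset.sum_congr rfl fun k _ => ?_
  have h1 : bernoulliCoeff r a ((k : ℤ) + 1) = (((k : ℝ) + 1) ^ (-r) : ℝ) *
      Complex.exp (-(Complex.I * (a * Real.pi / 2))) := by
    rw [bernoulliCoeff, if_neg (by omega), if_pos (by omega),
      show ((k : ℤ) + 1).natAbs = k + 1 by omega]
    push_cast
    rfl
  have h2 : bernoulliCoeff r a (-((k : ℤ) + 1)) = (((k : ℝ) + 1) ^ (-r) : ℝ) *
      starRingEnd ℂ (Complex.exp (-(Complex.I * (a * Real.pi / 2)))) := by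
    rw [bernoulliCoeff, if_neg (by omega), if_neg (by omega),
      show (-((k : ℤ) + 1)).natAbs = k + 1 by omega]
    push_cast
    rfl
  rw [h1, h2, fourier_neg, Complex.re_eq_add_conj, map_mul]
  ring

/-- A geometric sum with ratio different from 1; its boundedness in n is the input for Dirichlet's
test. -/
theorem norm_sum_fourier_le {x : AddCircle (2 * Real.pi)} (hx : x ≠ 0) (n : ℕ) :
    ‖∑ k ∈ Finset.range n, (fourier ((k : ℤ) + 1) x : ℂ)‖ ≤ 2 / ‖(fourier 1 x : ℂ) - 1‖ := by
  have h1 : (fourier 1 x : ℂ) ≠ 1 := by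
    rw [fourier_one]
    intro h
    refine hx (AddCircle.injective_toCircle Real.two_pi_pos.ne' ?_)
    rw [AddCircle.toCircle_zero]
    exact Circle.coe_injective h
  have h2 : ∀ k : ℕ, (fourier ((k : ℤ) + 1) x : ℂ) = fourier 1 x * fourier 1 x ^ k := by
    intro k
    induction k with
    | zero => simp
    | succ k ih => rw [Nat.cast_succ, fourier_add, ih, pow_succ]; ring
  have h3 : ‖(fourier 1 x : ℂ)‖ = 1 := Circle.norm_coe _
  simp only [h2]
  rw [← Finset.mul_sum, geom_sum_eq h1, norm_mul, norm_div, h3, one_mul]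
  gcongr
  refine (norm_sub_le _ _).trans ?_
  rw [norm_pow, h3]
  norm_num

/-- The partial sums of the Bernoulli series converge outside the origin. -/
theorem tendsto_bernoulliKernel {r : ℝ} (hr : 0 < r) (a : ℝ) {x : AddCircle (2 * Real.pi)}
    (hx : x ≠ 0) :
    Filter.Tendsto (fun n : ℕ => ∑ l ∈ Finset.Icc (-(n : ℤ)) n, bernoulliCoeff r a l * fourier l x)
      Filter.atTop (nhds (bernoulliKernel r a x : ℂ)) := by
  simp only [sum_bernoulliCoeff]
  refine (Complex.continuous_ofReal.tendsto _).comp ?_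
  have hanti : Antitone fun k : ℕ => ((k : ℝ) + 1) ^ (-r) := fun m n hmn =>
    Real.rpow_le_rpow_of_nonpos (by positivity) (by gcongr) (by linarith)
  have hzero : Filter.Tendsto (fun k : ℕ => ((k : ℝ) + 1) ^ (-r)) Filter.atTop (nhds 0) :=
    (tendsto_rpow_neg_atTop hr).comp
      (Filter.tendsto_atTop_add_const_right _ _ tendsto_natCast_atTop_atTop)
  have hbound : ∀ n, ‖∑ k ∈ Finset.range n,
      (fourier ((k : ℤ) + 1) x * Complex.exp (-(Complex.I * (a * Real.pi / 2)))).re‖ ≤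
      2 / ‖(fourier 1 x : ℂ) - 1‖ := by
    intro n
    rw [← Complex.re_sum, ← Finset.sum_mul]
    refine (Complex.abs_re_le_norm _).trans ?_
    rw [norm_mul, norm_exp_phase, mul_one]
    exact norm_sum_fourier_le hx n
  -- Dirichlet's test: monotone null coefficients against bounded partial sums.
  obtain ⟨L, hL⟩ := cauchySeq_tendsto_of_complete
    (hanti.cauchySeq_series_mul_of_tendsto_zero_of_bounded hzero hbound)
  simp only [smul_eq_mul] at hL
  have hsum : HasSum (fun k : ℕ => ((k : ℝ) + 1) ^ (-r) *
      (fourier ((k : ℤ) + 1) x * Complex.exp (-(Complex.I * (a * Real.pi / 2)))).re) L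
      (SummationFilter.conditional ℕ) := by
    rw [HasSum, SummationFilter.conditional_filter_eq_map_range]
    exact Filter.tendsto_map'_iff.2 hL
  rw [bernoulliKernel, hsum.tsum_eq]
  exact (hL.const_mul 2).const_add 1

theorem summable_norm_sq_bernoulliCoeff {r : ℝ} (hr : 1 / 2 < r) (a : ℝ) :
    Summable fun l => ‖bernoulliCoeff r a l‖ ^ 2 := by
  have h : Summable fun n : ℕ => (((max 1 n : ℕ) : ℝ) ^ (-r)) ^ 2 := by
    rw [← summable_nat_add_iff 1]
    have h1 : Summable fun n : ℕ => (((n + 1 : ℕ) : ℝ)) ^ (-(2 * r)) :=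
      (summable_nat_add_iff 1).2 (Real.summable_nat_rpow.2 (by linarith))
    refine h1.congr fun n => ?_
    rw [show max 1 (n + 1) = n + 1 by omega, ← Real.rpow_natCast, ← Real.rpow_mul (by positivity)]
    congr 1
    push_cast
    ring
  simp only [norm_bernoulliCoeff]
  refine Summable.of_nat_of_neg ?_ ?_
  · simpa using h
  · simpa using h

/-- For `r > 1/2` the Bernoulli kernel is square integrable, with the expected Fourier series. -/
theorem exists_bernoulliKernel_ae_eq {r : ℝ} (hr : 1 / 2 < r) (a : ℝ) :
    ∃ G : Lp ℂ 2 (AddCircle.haarAddCircle (T := 2 * Real.pi)),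
      (fun x => (bernoulliKernel r a x : ℂ)) =ᵐ[volume] G ∧
        ∀ l, fourierCoeff G l = bernoulliCoeff r a l := by
  have hmem : Memℓp (bernoulliCoeff r a) 2 := by
    refine memℓp_gen ?_
    simpa using summable_norm_sq_bernoulliCoeff hr a
  -- The L_2 function with the prescribed coefficients. Its symmetric partial sums converge to it in
  -- L_2, so a subsequence converges almost everywhere; the pointwise limit of the Bernoulli series
  -- away from 0 must agree with it.
  set G := (fourierBasis (T := 2 * Real.pi)).repr.symm ⟨_, hmem⟩ with hG
  have hGc : ∀ l, fourierCoeff G l = bernoulliCoeff r a l := fun l => by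
    rw [← fourierBasis_repr, hG, LinearIsometryEquiv.apply_symm_apply]
  refine ⟨G, ?_, hGc⟩
  have h1 := (hasSum_fourier_series_L2 G).comp Finset.tendsto_Icc_neg
  obtain ⟨ns, hns, hlim⟩ := (tendstoInMeasure_of_tendsto_Lp h1).exists_seq_tendsto_ae
  have h2 : ∀ᵐ x ∂(AddCircle.haarAddCircle (T := 2 * Real.pi)), ∀ l : ℤ,
      fourierLp 2 l x = fourier l x := ae_all_iff.2 fun l => coeFn_fourierLp 2 l
  have h3 : ∀ᵐ x ∂(AddCircle.haarAddCircle (T := 2 * Real.pi)), ∀ n : ℕ,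
      (∑ l ∈ Finset.Icc (-(n : ℤ)) n, fourierCoeff G l • fourierLp 2 l :
        Lp ℂ 2 (AddCircle.haarAddCircle (T := 2 * Real.pi))) x =
        ∑ l ∈ Finset.Icc (-(n : ℤ)) n, bernoulliCoeff r a l * fourier l x := by
    refine ae_all_iff.2 fun n => ?_
    have h4 : ∀ᵐ x ∂(AddCircle.haarAddCircle (T := 2 * Real.pi)), ∀ l : ℤ,
        (fourierCoeff G l • fourierLp 2 l :
          Lp ℂ 2 (AddCircle.haarAddCircle (T := 2 * Real.pi))) x =
        fourierCoeff G l • fourierLp 2 l x := ae_all_iff.2 fun l => Lp.coeFn_smul _ _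
    filter_upwards [h2, h4, Lp.coeFn_finsetSum (Finset.Icc (-(n : ℤ)) n)
      (fun l => fourierCoeff G l • fourierLp 2 l)] with x hx2 hx4 hx
    rw [hx, Finset.sum_apply]
    refine Finset.sum_congr rfl fun l _ => ?_
    rw [hx4, hx2, hGc, smul_eq_mul]
  have h5 : ∀ᵐ x ∂(volume : Measure (AddCircle (2 * Real.pi))), x ≠ 0 := by
    rw [ae_iff]
    simpa using AddCircle.volume_closedBall (T := 2 * Real.pi) (x := 0) 0
  have h6 : ∀ᵐ x ∂(volume : Measure (AddCircle (2 * Real.pi))),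
      Filter.Tendsto (fun i => ∑ l ∈ Finset.Icc (-(ns i : ℤ)) (ns i),
        bernoulliCoeff r a l * fourier l x) Filter.atTop (nhds (G x)) := by
    rw [AddCircle.volume_eq_smul_haarAddCircle]
    refine Measure.ae_smul_measure ?_ _
    filter_upwards [hlim, h3] with x hx hx3
    simpa only [Function.comp_apply, hx3] using hx
  filter_upwards [h5, h6] with x hx0 hx
  exact tendsto_nhds_unique ((tendsto_bernoulliKernel (by linarith) a hx0).comp
    hns.tendsto_atTop) hx

theorem memLp_bernoulliKernel {r : ℝ} (hr : 1 / 2 < r) (a : ℝ) :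
    MemLp (fun x => (bernoulliKernel r a x : ℂ)) 2 volume := by
  obtain ⟨G, hG, -⟩ := exists_bernoulliKernel_ae_eq hr a
  exact (memLp_congr_ae hG).2 (Lp.memLp G).of_haarAddCircle

theorem integral_fourier_mul_bernoulliKernel {r : ℝ} (hr : 1 / 2 < r) (a : ℝ) (l : ℤ) :
    ∫ x, fourier (-l) x * (bernoulliKernel r a x : ℂ) =
      ((2 * Real.pi : ℝ) : ℂ) * bernoulliCoeff r a l := by
  obtain ⟨G, hG, hc⟩ := exists_bernoulliKernel_ae_eq hr a
  rw [← hc, fourierCoeff, AddCircle.integral_haarAddCircle, ← Complex.real_smul,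
    smul_inv_smul₀ Real.two_pi_pos.ne']
  exact integral_congr_ae (hG.mono fun x hx => by simp only [hx, smul_eq_mul])

theorem aestronglyMeasurable_comp_eval {f : AddCircle (2 * Real.pi) → ℂ}
    (hf : AEStronglyMeasurable f volume) (j : Fin d) :
    AEStronglyMeasurable (fun x : Torus d => f (x j)) volume :=
  hf.comp_quasiMeasurePreserving (Measure.quasiMeasurePreserving_eval _ j)

theorem memLp_bernoulliKernelMulti {r : ℝ} (hr : 1 / 2 < r) (α : Fin d → ℝ) :
    MemLp (bernoulliKernelMulti r α) 2 volume := by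
  have hm : AEStronglyMeasurable (bernoulliKernelMulti r α) volume :=
    Finset.aestronglyMeasurable_fun_prod _ fun j _ =>
      aestronglyMeasurable_comp_eval (memLp_bernoulliKernel hr (α j)).aestronglyMeasurable j
  rw [memLp_two_iff_integrable_sq_norm hm]
  simp only [bernoulliKernelMulti, norm_prod, ← Finset.prod_pow]
  exact Integrable.fintype_prod (f := fun j t => ‖(bernoulliKernel r (α j) t : ℂ)‖ ^ 2) fun j =>
    (memLp_bernoulliKernel hr (α j)).integrable_norm_pow (by norm_num)

/-- The Fourier coefficients of the tensor product Bernoulli kernel. -/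
def bernoulliCoeffMulti (r : ℝ) (α : Fin d → ℝ) (k : Fin d → ℤ) : ℂ :=
  ∏ j, bernoulliCoeff r (α j) (k j)

theorem coeff_bernoulliKernelMulti {r : ℝ} (hr : 1 / 2 < r) (α : Fin d → ℝ) (k : Fin d → ℤ) :
    coeff (bernoulliKernelMulti r α) k = bernoulliCoeffMulti r α k := by
  simp only [coeff, character_apply, bernoulliKernelMulti, ← Finset.prod_mul_distrib]
  rw [integral_fintype_prod_volume_eq_prod
    (f := fun j t => fourier ((-k) j) t * (bernoulliKernel r (α j) t : ℂ))]
  simp only [Pi.neg_apply, integral_fourier_mul_bernoulliKernel hr, Finset.prod_mul_distrib,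
    Finset.prod_const, Finset.card_univ, Fintype.card_fin]
  rw [Complex.real_smul, ← mul_assoc, ← Complex.ofReal_pow, ← Complex.ofReal_mul,
    inv_mul_cancel₀ (two_pi_pow_pos d).ne', Complex.ofReal_one, one_mul]
  rfl

theorem norm_bernoulliCoeffMulti (r : ℝ) (α : Fin d → ℝ) (k : Fin d → ℤ) :
    ‖bernoulliCoeffMulti r α k‖ = ∏ j, ((max 1 (k j).natAbs : ℕ) : ℝ) ^ (-r) := by
  simp only [bernoulliCoeffMulti, norm_prod, norm_bernoulliCoeff]

theorem bernoulliCoeffMulti_ne_zero (r : ℝ) (α : Fin d → ℝ) (k : Fin d → ℤ) :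
    bernoulliCoeffMulti r α k ≠ 0 := by
  rw [← norm_pos_iff, norm_bernoulliCoeffMulti]
  exact Finset.prod_pos fun j _ => Real.rpow_pos_of_pos (by positivity) _

/-- The convolution of two square integrable functions is bounded. -/
theorem memLp_top_conv {g f : Torus d → ℂ} (hg : MemLp g 2) (hf : MemLp f 2) :
    MemLp (conv g f) ∞ volume := by
  have hm := aestronglyMeasurable_conv (hg.integrable one_le_two) (hf.integrable one_le_two)
  refine memLp_top_of_bound hm (((2 * Real.pi) ^ d)⁻¹ *
    ((∫ y, ‖g y‖ ^ 2) + ∫ y, ‖f y‖ ^ 2)) (Filter.Eventually.of_forall fun x => ?_)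
  have hg2 := (hg.integrable_norm_pow (by norm_num))
  have hf2 := (hf.integrable_norm_pow (by norm_num))
  rw [conv, norm_smul, norm_inv, Real.norm_of_nonneg (two_pi_pow_pos d).le]
  refine mul_le_mul_of_nonneg_left ?_ (by positivity)
  have hg3 : Integrable fun y => ‖g (x - y)‖ ^ 2 := hg2.comp_sub_left x
  have hg4 : ∫ y, ‖g (x - y)‖ ^ 2 = ∫ y, ‖g y‖ ^ 2 :=
    integral_sub_left_eq_self (fun y => ‖g y‖ ^ 2) volume x
  rw [← hg4, ← integral_add hg3 hf2]
  refine norm_integral_le_of_norm_le (hg3.add hf2) (Filter.Eventually.of_forall fun y => ?_)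
  rw [norm_mul]
  -- The inequality ab ≤ a² + b² replaces Cauchy–Schwarz, as only boundedness is wanted.
  nlinarith [sq_nonneg (‖g (x - y)‖ - ‖f y‖), sq_nonneg (‖g (x - y)‖), sq_nonneg ‖f y‖]

/-! ## Integral inequalities for real interpolation -/

/-- The layer cake formula for a single value. It includes x = ∞, since it is applied to
K-functionals that are not yet known to be finite. -/
theorem lintegral_ite_lt_rpow {q : ℝ} (hq : 0 < q) (x : ℝ≥0∞) :
    ∫⁻ l in Set.Ioi (0 : ℝ), (if ENNReal.ofReal l < x then ENNReal.ofReal (l ^ (q - 1)) else 0) =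
      x ^ q / ENNReal.ofReal q := by
  have hfin : ∀ a : ℝ, 0 ≤ a → ∫⁻ l in Set.Ioi (0 : ℝ),
      (if ENNReal.ofReal l < ENNReal.ofReal a then ENNReal.ofReal (l ^ (q - 1)) else 0) =
      ENNReal.ofReal a ^ q / ENNReal.ofReal q := by
    intro a ha
    have h1 : ∀ l ∈ Set.Ioi (0 : ℝ),
        (if ENNReal.ofReal l < ENNReal.ofReal a then ENNReal.ofReal (l ^ (q - 1)) else 0) =
        (Set.Ioo 0 a).indicator (fun l => ENNReal.ofReal (l ^ (q - 1))) l := by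
      intro l hl
      rw [Set.mem_Ioi] at hl
      rw [Set.indicator_apply]
      refine if_congr ?_ rfl rfl
      rw [ENNReal.ofReal_lt_ofReal_iff_of_nonneg hl.le, Set.mem_Ioo]
      exact ⟨fun h => ⟨hl, h⟩, fun h => h.2⟩
    rw [setLIntegral_congr_fun measurableSet_Ioi h1, lintegral_indicator measurableSet_Ioo,
      Measure.restrict_restrict measurableSet_Ioo,
      Set.inter_eq_left.2 fun l hl => Set.mem_Ioi.2 hl.1]
    have hint : IntegrableOn (fun l : ℝ => l ^ (q - 1)) (Set.Ioc 0 a) :=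
      (intervalIntegrable_iff_integrableOn_Ioc_of_le ha).1
        (intervalIntegral.intervalIntegrable_rpow' (by linarith))
    have hnn : 0 ≤ᵐ[volume.restrict (Set.Ioc 0 a)] fun l : ℝ => l ^ (q - 1) := by
      filter_upwards [ae_restrict_mem measurableSet_Ioc] with l hl
      exact Real.rpow_nonneg hl.1.le _
    rw [restrict_Ioo_eq_restrict_Ioc, ← ofReal_integral_eq_lintegral_ofReal hint hnn,
      ← intervalIntegral.integral_of_le ha, integral_rpow (Or.inl (by linarith)),
      ENNReal.ofReal_rpow_of_nonneg ha hq.le, ← ENNReal.ofReal_div_of_pos hq]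
    congr 1
    rw [sub_add_cancel, Real.zero_rpow hq.ne', sub_zero]
  induction x with
  | coe x =>
    have := hfin x x.2
    rwa [ENNReal.ofReal_coe_nnreal] at this
  | top =>
    rw [ENNReal.top_rpow_of_pos hq, ENNReal.top_div_of_ne_top ENNReal.ofReal_ne_top, eq_top_iff]
    have h2 : Filter.Tendsto (fun n : ℕ => ENNReal.ofReal n ^ q / ENNReal.ofReal q) Filter.atTop
        (nhds ∞) := by
      have h3 : Filter.Tendsto (fun n : ℕ => ENNReal.ofReal ((n : ℝ) ^ q / q)) Filter.atTop
          (nhds ∞) := ENNReal.tendsto_ofReal_nhds_top.2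
        (((tendsto_rpow_atTop hq).comp tendsto_natCast_atTop_atTop).atTop_div_const hq)
      refine h3.congr fun n => ?_
      rw [ENNReal.ofReal_div_of_pos hq, ENNReal.ofReal_rpow_of_nonneg (by positivity) hq.le]
    refine le_of_tendsto' h2 fun n => ?_
    rw [← hfin n (by positivity)]
    refine lintegral_mono fun l => ?_
    rw [if_pos ENNReal.ofReal_lt_top]
    split_ifs
    · exact le_rfl
    · exact zero_le

theorem lintegral_Ioi_rpow_neg_three {τ : ℝ} (hτ : 0 < τ) :
    ∫⁻ t in Set.Ioi τ, ENNReal.ofReal (t ^ (-3 : ℝ)) = ENNReal.ofReal (τ ^ (-2 : ℝ) / 2) := by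
  rw [← ofReal_integral_eq_lintegral_ofReal (integrableOn_Ioi_rpow_of_lt (by norm_num) hτ),
    integral_Ioi_rpow_of_lt (by norm_num) hτ]
  · norm_num
  · filter_upwards [ae_restrict_mem measurableSet_Ioi] with t ht
    exact Real.rpow_nonneg (hτ.trans ht).le _

/-- For finite x > 0 the condition means t > l/√x, and the integral of t^{-3} over that half-line is
x/(2l²). -/
theorem lintegral_ite_sq_lt_le {l : ℝ} (hl : 0 < l) (x : ℝ≥0∞) :
    ∫⁻ t in Set.Ioi (0 : ℝ), (if ENNReal.ofReal (l ^ 2) < ENNReal.ofReal (t ^ 2) * x then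
      ENNReal.ofReal (t ^ (-3 : ℝ)) else 0) ≤ ENNReal.ofReal (l ^ (-2 : ℝ)) * x := by
  have hpos : 0 < ENNReal.ofReal (l ^ (-2 : ℝ)) := ENNReal.ofReal_pos.2 (Real.rpow_pos_of_pos hl _)
  induction x with
  | top =>
    rw [ENNReal.mul_top hpos.ne']
    exact le_top
  | coe b =>
    rcases eq_or_ne b 0 with rfl | hb
    · simp
    have hb' : (0 : ℝ) < b := by positivity
    set τ : ℝ := l / Real.sqrt b with hτdef
    have hτ : 0 < τ := by positivity
    have hτ2 : τ ^ 2 = l ^ 2 / b := by rw [hτdef, div_pow, Real.sq_sqrt hb'.le]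
    calc _ ≤ ∫⁻ t in Set.Ioi (0 : ℝ),
          (Set.Ioi τ).indicator (fun t => ENNReal.ofReal (t ^ (-3 : ℝ))) t := by
          refine setLIntegral_mono' measurableSet_Ioi fun t ht => ?_
          rw [Set.mem_Ioi] at ht
          split_ifs with h
          · rw [Set.indicator_of_mem]
            rw [Set.mem_Ioi]
            rw [← ENNReal.ofReal_coe_nnreal, ← ENNReal.ofReal_mul (by positivity),
              ENNReal.ofReal_lt_ofReal_iff_of_nonneg (by positivity)] at h
            refine lt_of_pow_lt_pow_left₀ 2 ht.le ?_
            rw [hτ2, div_lt_iff₀ hb']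
            exact h
          · exact zero_le
      _ = ENNReal.ofReal (τ ^ (-2 : ℝ) / 2) := by
          rw [lintegral_indicator measurableSet_Ioi, Measure.restrict_restrict measurableSet_Ioi,
            Set.inter_eq_left.2 (Set.Ioi_subset_Ioi hτ.le), lintegral_Ioi_rpow_neg_three hτ]
      _ ≤ _ := by
          rw [← ENNReal.ofReal_coe_nnreal, ← ENNReal.ofReal_mul (by positivity)]
          refine ENNReal.ofReal_le_ofReal ?_
          rw [Real.rpow_neg hτ.le, Real.rpow_two, hτ2, Real.rpow_neg hl.le, Real.rpow_two, inv_div]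
          have : 0 ≤ (b : ℝ) / l ^ 2 := by positivity
          rw [inv_mul_eq_div]
          linarith

/-- If `K(t) ≤ Cλ` whenever `t² φ(λ) ≤ λ²`, then `∫ t^{-2} K(t)^p dt/t` is controlled by
`∫ λ^{p-3} φ(λ) dλ`. -/
theorem lintegral_rpow_le_of_le_of_sq_mul_le {K φ : ℝ → ℝ≥0∞} (hK : Measurable K) {p : ℝ}
    (hp : 0 < p) {C : ℝ≥0} (hC : C ≠ 0)
    (h : ∀ t > 0, ∀ l > 0, ENNReal.ofReal (t ^ 2) * φ l ≤ ENNReal.ofReal (l ^ 2) →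
      K t ≤ C * ENNReal.ofReal l) :
    ∫⁻ t in Set.Ioi (0 : ℝ), ENNReal.ofReal (t ^ (-3 : ℝ)) * K t ^ p ≤
      (C : ℝ≥0∞) ^ p * ENNReal.ofReal p *
        ∫⁻ l in Set.Ioi (0 : ℝ), ENNReal.ofReal (l ^ (p - 3)) * φ l := by
  have hC0 : (C : ℝ≥0∞) ≠ 0 := by exact_mod_cast hC
  have hp0 : ENNReal.ofReal p ≠ 0 := (ENNReal.ofReal_pos.2 hp).ne'
  -- Layer cake for K/C: by the hypothesis, the height l contributes at t only if l² < t² φ(l), and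
  -- after Fubini the t-integral of that condition is explicit.
  have hKp : ∀ t, K t ^ p = (C : ℝ≥0∞) ^ p * ENNReal.ofReal p * ∫⁻ l in Set.Ioi (0 : ℝ),
      (if ENNReal.ofReal l < K t / C then ENNReal.ofReal (l ^ (p - 1)) else 0) := by
    intro t
    rw [lintegral_ite_lt_rpow hp, mul_assoc, ENNReal.mul_div_cancel hp0 ENNReal.ofReal_ne_top,
      ← ENNReal.mul_rpow_of_nonneg _ _ hp.le, ENNReal.mul_div_cancel hC0 ENNReal.coe_ne_top]
  have hmeas : Measurable (Function.uncurry fun t l : ℝ =>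
      ENNReal.ofReal (t ^ (-3 : ℝ)) *
        (if ENNReal.ofReal l < K t / C then ENNReal.ofReal (l ^ (p - 1)) else 0)) := by
    refine Measurable.mul (by fun_prop) (Measurable.ite ?_ (by fun_prop) measurable_const)
    exact measurableSet_lt (by fun_prop) ((hK.comp measurable_fst).div_const _)
  have hcne : (C : ℝ≥0∞) ^ p * ENNReal.ofReal p ≠ ∞ :=
    ENNReal.mul_ne_top (ENNReal.rpow_ne_top_of_nonneg hp.le ENNReal.coe_ne_top)
      ENNReal.ofReal_ne_top
  calc ∫⁻ t in Set.Ioi (0 : ℝ), ENNReal.ofReal (t ^ (-3 : ℝ)) * K t ^ p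
      = (C : ℝ≥0∞) ^ p * ENNReal.ofReal p * ∫⁻ t in Set.Ioi (0 : ℝ), ∫⁻ l in Set.Ioi (0 : ℝ),
          ENNReal.ofReal (t ^ (-3 : ℝ)) *
            (if ENNReal.ofReal l < K t / C then ENNReal.ofReal (l ^ (p - 1)) else 0) := by
        rw [← lintegral_const_mul' _ _ hcne]
        refine lintegral_congr fun t => ?_
        rw [lintegral_const_mul' _ _ ENNReal.ofReal_ne_top, hKp t]
        ring
    _ = (C : ℝ≥0∞) ^ p * ENNReal.ofReal p * ∫⁻ l in Set.Ioi (0 : ℝ), ∫⁻ t in Set.Ioi (0 : ℝ),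
          ENNReal.ofReal (t ^ (-3 : ℝ)) *
            (if ENNReal.ofReal l < K t / C then ENNReal.ofReal (l ^ (p - 1)) else 0) := by
        rw [lintegral_lintegral_swap hmeas.aemeasurable]
    _ ≤ _ := by
        refine mul_le_mul_right (setLIntegral_mono' measurableSet_Ioi fun l hl => ?_) _
        rw [Set.mem_Ioi] at hl
        calc _ ≤ ∫⁻ t in Set.Ioi (0 : ℝ), ENNReal.ofReal (l ^ (p - 1)) *
              (if ENNReal.ofReal (l ^ 2) < ENNReal.ofReal (t ^ 2) * φ l then
                ENNReal.ofReal (t ^ (-3 : ℝ)) else 0) := by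
              refine setLIntegral_mono' measurableSet_Ioi fun t ht => ?_
              rw [Set.mem_Ioi] at ht
              by_cases h1 : ENNReal.ofReal (l ^ 2) < ENNReal.ofReal (t ^ 2) * φ l
              · rw [if_pos h1]
                split_ifs
                · exact (mul_comm _ _).le
                · simp
              · have h2 := h t ht l hl (not_lt.1 h1)
                rw [if_neg h1, if_neg, mul_zero, mul_zero]
                rw [not_lt]
                exact ENNReal.div_le_of_le_mul' h2
          _ ≤ ENNReal.ofReal (l ^ (p - 1)) * (ENNReal.ofReal (l ^ (-2 : ℝ)) * φ l) := by
              rw [lintegral_const_mul' _ _ ENNReal.ofReal_ne_top]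
              exact mul_le_mul_right (lintegral_ite_sq_lt_le hl _) _
          _ = _ := by
              rw [← mul_assoc, ← ENNReal.ofReal_mul (by positivity), ← Real.rpow_add hl]
              congr 3
              ring

/-- If K crosses the height x between t and 2t, the tail beyond 2t contributes (2t)^{-2}/2 =
t^{-2}/8, whence the 8. Otherwise either K stays below x along 2^n t, which forces y = 0, or K
exceeds x on the whole half-line and the integral diverges at 0. Using doubling avoids any
continuity of K. -/
theorem le_lintegral_of_le_rpow_neg_two {K : ℝ → ℝ≥0∞} (hK : Monotone K) {C x y : ℝ≥0∞}
    (hC : C ≠ 0) (hC' : C ≠ ∞) (h : ∀ t > 0, K t ≤ x → y ≤ C * ENNReal.ofReal (t ^ (-2 : ℝ))) :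
    y ≤ 8 * C * ∫⁻ t in Set.Ioi (0 : ℝ),
      (if x < K t then ENNReal.ofReal (t ^ (-3 : ℝ)) else 0) := by
  have htail : ∀ τ > 0, x < K τ → ENNReal.ofReal (τ ^ (-2 : ℝ) / 2) ≤
      ∫⁻ t in Set.Ioi (0 : ℝ), (if x < K t then ENNReal.ofReal (t ^ (-3 : ℝ)) else 0) := by
    intro τ hτ hx
    rw [← lintegral_Ioi_rpow_neg_three hτ]
    refine le_trans (setLIntegral_mono' measurableSet_Ioi fun t ht => ?_)
      (lintegral_mono_set (Set.Ioi_subset_Ioi hτ.le))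
    rw [if_pos (hx.trans_le (hK (Set.mem_Ioi.1 ht).le))]
  by_cases h1 : ∃ t > 0, K t ≤ x ∧ x < K (2 * t)
  · obtain ⟨t, ht, h2, h3⟩ := h1
    refine (h t ht h2).trans ?_
    rw [mul_comm 8 C, mul_assoc]
    refine mul_le_mul_right (le_trans ?_ (mul_le_mul_right (htail (2 * t) (by positivity) h3) _)) _
    rw [show (8 : ℝ≥0∞) = ENNReal.ofReal 8 by simp, ← ENNReal.ofReal_mul (by norm_num)]
    refine ENNReal.ofReal_le_ofReal ?_
    rw [Real.mul_rpow (by norm_num) ht.le]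
    norm_num [Real.rpow_neg]
    linarith
  push Not at h1
  by_cases h2 : ∃ t > 0, K t ≤ x
  · obtain ⟨t, ht, h3⟩ := h2
    have h4 : ∀ n : ℕ, K (2 ^ n * t) ≤ x := by
      intro n
      induction n with
      | zero => simpa using h3
      | succ n ih =>
        rw [pow_succ', mul_assoc]
        exact h1 _ (by positivity) ih
    have h5 : Filter.Tendsto (fun n : ℕ => C * ENNReal.ofReal ((2 ^ n * t) ^ (-2 : ℝ)))
        Filter.atTop (nhds (C * ENNReal.ofReal 0)) := by
      refine ENNReal.Tendsto.const_mul (ENNReal.tendsto_ofReal ?_) (Or.inr hC')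
      exact (tendsto_rpow_neg_atTop (by norm_num)).comp
        ((tendsto_pow_atTop_atTop_of_one_lt one_lt_two).atTop_mul_const ht)
    have h6 : y ≤ C * ENNReal.ofReal 0 := ge_of_tendsto' h5 fun n => h _ (by positivity) (h4 n)
    rw [ENNReal.ofReal_zero, mul_zero] at h6
    exact h6.trans zero_le
  · push Not at h2
    have h3 : ∞ ≤ ∫⁻ t in Set.Ioi (0 : ℝ),
        (if x < K t then ENNReal.ofReal (t ^ (-3 : ℝ)) else 0) := by
      have h4 : Filter.Tendsto (fun n : ℕ => ENNReal.ofReal (((((n : ℝ) + 1)⁻¹) ^ (-2 : ℝ)) / 2))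
          Filter.atTop (nhds ∞) := by
        refine ENNReal.tendsto_ofReal_nhds_top.2 (Filter.Tendsto.atTop_div_const (by norm_num) ?_)
        have h5 : Filter.Tendsto (fun n : ℕ => ((n : ℝ) + 1) ^ (2 : ℝ)) Filter.atTop
            Filter.atTop := (tendsto_rpow_atTop (by norm_num)).comp
          (Filter.tendsto_atTop_add_const_right _ _ tendsto_natCast_atTop_atTop)
        refine h5.congr fun n => ?_
        rw [Real.inv_rpow (by positivity), Real.rpow_neg (by positivity), inv_inv]
      exact le_of_tendsto' h4 fun n => htail _ (by positivity) (h2 _ (by positivity))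
    rw [top_le_iff.1 h3, ENNReal.mul_top (mul_ne_zero (by norm_num) hC)]
    exact le_top

/-- If `D(λ) ≤ C t^{-2}` whenever `K(t) ≤ λ`, then `∫ λ^{p-1} D(λ) dλ` is controlled by
`∫ t^{-2} K(t)^p dt/t`. -/
theorem lintegral_rpow_mul_le_of_le_rpow_neg_two {K D : ℝ → ℝ≥0∞} (hK : Monotone K) {p : ℝ}
    (hp : 0 < p) {C : ℝ≥0∞} (hC : C ≠ 0) (hC' : C ≠ ∞)
    (h : ∀ t > 0, ∀ l > 0, K t ≤ ENNReal.ofReal l → D l ≤ C * ENNReal.ofReal (t ^ (-2 : ℝ))) :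
    ∫⁻ l in Set.Ioi (0 : ℝ), ENNReal.ofReal (l ^ (p - 1)) * D l ≤
      8 * C / ENNReal.ofReal p *
        ∫⁻ t in Set.Ioi (0 : ℝ), ENNReal.ofReal (t ^ (-3 : ℝ)) * K t ^ p := by
  have hp0 : ENNReal.ofReal p ≠ 0 := (ENNReal.ofReal_pos.2 hp).ne'
  have h8 : 8 * C ≠ ∞ := ENNReal.mul_ne_top (by norm_num) hC'
  have hmeas : Measurable (Function.uncurry fun l t : ℝ => ENNReal.ofReal (l ^ (p - 1)) *
      (if ENNReal.ofReal l < K t then ENNReal.ofReal (t ^ (-3 : ℝ)) else 0)) := by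
    refine Measurable.mul (by fun_prop) (Measurable.ite ?_ (by fun_prop) measurable_const)
    exact measurableSet_lt (by fun_prop) (hK.measurable.comp measurable_snd)
  calc ∫⁻ l in Set.Ioi (0 : ℝ), ENNReal.ofReal (l ^ (p - 1)) * D l
      ≤ ∫⁻ l in Set.Ioi (0 : ℝ), 8 * C * ∫⁻ t in Set.Ioi (0 : ℝ), ENNReal.ofReal (l ^ (p - 1)) *
          (if ENNReal.ofReal l < K t then ENNReal.ofReal (t ^ (-3 : ℝ)) else 0) := by
        refine setLIntegral_mono' measurableSet_Ioi fun l hl => ?_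
        rw [lintegral_const_mul' _ _ ENNReal.ofReal_ne_top, mul_left_comm]
        exact mul_le_mul_right (le_lintegral_of_le_rpow_neg_two hK hC hC' fun t ht =>
          h t ht l hl) _
    _ = 8 * C * ∫⁻ t in Set.Ioi (0 : ℝ), ∫⁻ l in Set.Ioi (0 : ℝ), ENNReal.ofReal (l ^ (p - 1)) *
          (if ENNReal.ofReal l < K t then ENNReal.ofReal (t ^ (-3 : ℝ)) else 0) := by
        rw [lintegral_const_mul' _ _ h8, lintegral_lintegral_swap hmeas.aemeasurable]
    _ = 8 * C * ∫⁻ t in Set.Ioi (0 : ℝ), (ENNReal.ofReal p)⁻¹ *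
          (ENNReal.ofReal (t ^ (-3 : ℝ)) * K t ^ p) := by
        congr 1
        refine lintegral_congr fun t => ?_
        calc _ = ∫⁻ l in Set.Ioi (0 : ℝ), ENNReal.ofReal (t ^ (-3 : ℝ)) *
              (if ENNReal.ofReal l < K t then ENNReal.ofReal (l ^ (p - 1)) else 0) := by
              refine lintegral_congr fun l => ?_
              split_ifs
              · exact mul_comm _ _
              · simp
          _ = _ := by
              rw [lintegral_const_mul' _ _ ENNReal.ofReal_ne_top, lintegral_ite_lt_rpow hp,
                div_eq_mul_inv]
              ring
    _ = _ := by
        rw [lintegral_const_mul' _ _ (ENNReal.inv_ne_top.2 hp0), div_eq_mul_inv, mul_assoc, mul_assoc,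
          mul_assoc]

/-! ## Dyadic weights -/

/-- The weight `2^{ρ|s|_1}`. -/
def dyadicWeight (ρ : ℝ) (s : Fin d → ℕ) : ℝ≥0∞ :=
  ENNReal.ofReal (2 ^ (ρ * ((∑ i, s i : ℕ) : ℝ)))

theorem dyadicWeight_add (ρ σ : ℝ) (s : Fin d → ℕ) :
    dyadicWeight (ρ + σ) s = dyadicWeight ρ s * dyadicWeight σ s := by
  rw [dyadicWeight, dyadicWeight, dyadicWeight, ← ENNReal.ofReal_mul (by positivity),
    ← Real.rpow_add two_pos, add_mul]

theorem dyadicWeight_mul (ρ q : ℝ) (s : Fin d → ℕ) :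
    dyadicWeight (ρ * q) s = dyadicWeight ρ s ^ q := by
  rw [dyadicWeight, dyadicWeight, ENNReal.ofReal_rpow_of_pos (by positivity),
    ← Real.rpow_mul two_pos.le]
  congr 2
  ring

theorem dyadicWeight_ne_top (ρ : ℝ) (s : Fin d → ℕ) : dyadicWeight ρ s ≠ ∞ :=
  ENNReal.ofReal_ne_top

theorem dyadicWeight_mul_neg (ρ : ℝ) (s : Fin d → ℕ) :
    dyadicWeight ρ s * dyadicWeight (-ρ) s = 1 := by
  rw [← dyadicWeight_add, add_neg_cancel, dyadicWeight]
  simp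

theorem tsum_prod_eq_pow (a : ℕ → ℝ≥0∞) :
    ∑' s : Fin d → ℕ, ∏ i, a (s i) = (∑' n, a n) ^ d := by
  induction d with
  | zero => simp
  | succ d ih =>
    rw [← (Fin.consEquiv fun _ : Fin (d + 1) => ℕ).tsum_eq, ENNReal.tsum_prod']
    simp only [Fin.consEquiv_apply, Fin.prod_univ_succ, Fin.cons_zero, Fin.cons_succ,
      ENNReal.tsum_mul_left, ENNReal.tsum_mul_right, ih, pow_succ']

theorem tsum_dyadicWeight_neg_ne_top {ρ : ℝ} (hρ : 0 < ρ) :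
    ∑' s : Fin d → ℕ, dyadicWeight (-ρ) s ≠ ∞ := by
  have h : ∀ s : Fin d → ℕ, dyadicWeight (-ρ) s =
      ∏ i, (ENNReal.ofReal (2 ^ (-ρ))) ^ (s i) := by
    intro s
    rw [Finset.prod_pow_eq_pow_sum, dyadicWeight, Real.rpow_mul two_pos.le, Real.rpow_natCast,
      ENNReal.ofReal_pow (by positivity)]
  simp only [h]
  rw [tsum_prod_eq_pow, ENNReal.tsum_geometric]
  refine ENNReal.pow_ne_top (ENNReal.inv_ne_top.2 ?_)
  rw [Ne, tsub_eq_zero_iff_le, not_le, ENNReal.ofReal_lt_one]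
  exact Real.rpow_lt_one_of_one_lt_of_neg one_lt_two (by linarith)

open Classical in
/-- The sum of `2^{-ρ|s|_1}` over the `s` with `s_i ≥ S_i - 2` is of the order `2^{-ρ|S|_1}`. -/
theorem tsum_dyadicWeight_neg_le (ρ : ℝ) (S : Fin d → ℕ) :
    ∑' s : Fin d → ℕ, (if ∀ i, S i ≤ s i + 2 then dyadicWeight (-ρ) s else 0) ≤
      ENNReal.ofReal (2 ^ (ρ * (2 * d))) * dyadicWeight (-ρ) S *
        ∑' n : Fin d → ℕ, dyadicWeight (-ρ) n := by
  set T : Set (Fin d → ℕ) := {s | ∀ i, S i ≤ s i + 2}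
  have h1 : ∀ s : Fin d → ℕ, (if ∀ i, S i ≤ s i + 2 then dyadicWeight (-ρ) s else 0) =
      T.indicator (dyadicWeight (-ρ)) s := fun s => by
    rw [Set.indicator_apply]
    rfl
  simp only [h1]
  rw [← tsum_subtype T, ← ENNReal.tsum_mul_left]
  -- The shift n_i = s_i + 2 - S_i is injective on the admissible s and satisfies |n|_1 + |S|_1 =
  -- |s|_1 + 2d, which produces the factor 2^{2dρ}.
  set e : T → Fin d → ℕ := fun s i => s.1 i + 2 - S i
  have he : Function.Injective e := by
    intro s s' hss
    ext i
    have h2 := congrFun hss i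
    have h3 := s.2 i
    have h4 := s'.2 i
    simp only [e] at h2
    omega
  refine le_trans (le_of_eq (tsum_congr fun s => ?_)) (ENNReal.tsum_comp_le_tsum_of_injective he _)
  simp only [dyadicWeight]
  rw [← ENNReal.ofReal_mul (by positivity), ← ENNReal.ofReal_mul (by positivity),
    ← Real.rpow_add two_pos, ← Real.rpow_add two_pos]
  congr 2
  have h5 : ∑ i, e s i + ∑ i, S i = ∑ i, s.1 i + 2 * d := by
    rw [← Finset.sum_add_distrib]
    have h6 : ∀ i, e s i + S i = s.1 i + 2 := fun i => Nat.sub_add_cancel (s.2 i)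
    simp [h6, Finset.sum_add_distrib, mul_comm]
  have h7 : ((∑ i, e s i : ℕ) : ℝ) + ((∑ i, S i : ℕ) : ℝ) = ((∑ i, s.1 i : ℕ) : ℝ) + 2 * d := by
    exact_mod_cast h5
  linear_combination ρ * h7

/-! ## The Besov norm as a weighted `L_p` norm -/

/-- The `p`-th power of the norm of `B^{r+1/p}_{p,p}`: the integral of `(2^{r|s|_1} |A_s(f)|)^p`
with respect to the measure `∑_s 2^{|s|_1} dx`. -/
def blockEnergy (r p : ℝ) (f : Torus d → ℂ) : ℝ≥0∞ :=
  ∑' s : Fin d → ℕ, dyadicWeight 1 s * ∫⁻ x, (dyadicWeight r s * ‖block s f x‖ₑ) ^ p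

/-- Because rp = r₀p + 1, the surplus factor 2^{|s|_1} passes into the measure. -/
theorem blockNorm_eq {r₀ r p : ℝ} (hp : 0 < p) (hr : r = r₀ + 1 / p) (f : Torus d → ℂ) :
    blockNorm r (ENNReal.ofReal p) (ENNReal.ofReal p) f = blockEnergy r₀ p f ^ (1 / p) := by
  rw [blockNorm, if_neg ENNReal.ofReal_ne_top, ENNReal.toReal_ofReal hp.le, blockEnergy]
  congr 1
  refine tsum_congr fun s => ?_
  rw [eLpNorm_eq_lintegral_rpow_enorm_toReal (ENNReal.ofReal_pos.2 hp).ne' ENNReal.ofReal_ne_top,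
    ENNReal.toReal_ofReal hp.le, one_div, ENNReal.rpow_inv_rpow hp.ne']
  simp only [ENNReal.mul_rpow_of_nonneg _ _ hp.le]
  rw [lintegral_const_mul' _ _ (ENNReal.rpow_ne_top_of_nonneg hp.le (dyadicWeight_ne_top _ _)),
    ← mul_assoc, ← dyadicWeight_mul, ← dyadicWeight_add, dyadicWeight]
  congr 3
  have : r * p = 1 + r₀ * p := by rw [hr]; field_simp; ring
  linear_combination ((∑ i, s i : ℕ) : ℝ) * this

/-- With θp = 2 the weight t^{-θp} dt/t is t^{-3} dt. -/
theorem interpolationNorm_eq {E : Type*} [AddCommGroup E] (N₀ N₁ : E → ℝ≥0∞) {θ p : ℝ}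
    (hp : 0 < p) (hθ : θ = 2 / p) (a : E) :
    interpolationNorm N₀ N₁ θ p a =
      (∫⁻ t in Set.Ioi (0 : ℝ), ENNReal.ofReal (t ^ (-3 : ℝ)) * kFunctional N₀ N₁ t a ^ p) ^
        (1 / p) := by
  rw [interpolationNorm]
  congr 1
  refine setLIntegral_congr_fun measurableSet_Ioi fun t ht => ?_
  rw [Set.mem_Ioi] at ht
  rw [ENNReal.mul_rpow_of_nonneg _ _ hp.le, mul_right_comm,
    ENNReal.ofReal_rpow_of_nonneg (by positivity) hp.le, ← Real.rpow_mul ht.le,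
    ← ENNReal.ofReal_mul (by positivity), ← Real.rpow_neg_one, ← Real.rpow_add ht]
  congr 3
  rw [hθ]
  field_simp
  norm_num

theorem monotone_kFunctional {E : Type*} [AddCommGroup E] (N₀ N₁ : E → ℝ≥0∞) (a : E) :
    Monotone fun t => kFunctional N₀ N₁ t a := by
  intro t t' htt
  refine iInf_mono fun a₀ => iInf_mono fun a₁ => iInf_mono fun _ => ?_
  gcongr

theorem exists_of_kFunctional_lt {E : Type*} [AddCommGroup E] {N₀ N₁ : E → ℝ≥0∞} {t : ℝ} {a : E}
    {x : ℝ≥0∞} (h : kFunctional N₀ N₁ t a < x) :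
    ∃ a₀ a₁, a = a₀ + a₁ ∧ N₀ a₀ + ENNReal.ofReal t * N₁ a₁ < x := by
  simp only [kFunctional, iInf_lt_iff] at h
  obtain ⟨a₀, a₁, h1, h2⟩ := h
  exact ⟨a₀, a₁, h1, h2⟩

theorem block_congr_ae (s : Fin d → ℕ) {f g : Torus d → ℂ} (h : f =ᵐ[volume] g) :
    block s f = block s g :=
  conv_congr_ae _ h

theorem memLp_of_continuous {f : Torus d → ℂ} (hf : Continuous f) (p : ℝ≥0∞) :
    MemLp f p volume :=
  MemLp.mono_exponent (memLp_top_of_bound hf.aestronglyMeasurable (‖(⟨f, hf⟩ : C(Torus d, ℂ))‖)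
    (Filter.Eventually.of_forall fun x => ContinuousMap.norm_coe_le_norm ⟨f, hf⟩ x)) le_top

/-! ## The lower estimate -/

theorem two_rpow_mul_sum (ρ : ℝ) (s : Fin d → ℕ) :
    (2 : ℝ) ^ (ρ * ((∑ i, s i : ℕ) : ℝ)) = ∏ i, ((2 ^ s i : ℕ) : ℝ) ^ ρ := by
  rw [Real.finsetProd_rpow _ _ fun i _ => by positivity]
  push_cast
  rw [Finset.prod_pow_eq_pow_sum, ← Real.rpow_natCast, ← Real.rpow_mul two_pos.le]
  push_cast
  ring_nf

/-- On the spectrum of A_s one has 2^{s_i} ≤ 2 max(1,|k_i|), which costs a factor 2^r in each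
coordinate. -/
theorem dyadicWeight_mul_bernoulliCoeffMulti_le {r : ℝ} (hr : 0 ≤ r) (α : Fin d → ℝ)
    {s : Fin d → ℕ} {k : Fin d → ℤ} (h : blockWeightMulti s k ≠ 0) :
    dyadicWeight r s * ‖bernoulliCoeffMulti r α k‖ₑ ≤ ENNReal.ofReal (2 ^ r) ^ d := by
  rw [← ofReal_norm, norm_bernoulliCoeffMulti, dyadicWeight, two_rpow_mul_sum,
    ← ENNReal.ofReal_mul (by positivity), ← ENNReal.ofReal_pow (by positivity),
    ← Finset.prod_mul_distrib]
  refine ENNReal.ofReal_le_ofReal ?_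
  calc _ ≤ ∏ _i : Fin d, (2 : ℝ) ^ r := by
        refine Finset.prod_le_prod (fun i _ => by positivity) fun i _ => ?_
        have h1 := two_pow_le_of_blockWeight_ne_zero (blockWeight_ne_zero_of_multi h i)
        have h2 : ((2 ^ s i : ℕ) : ℝ) ≤ 2 * ((max 1 (k i).natAbs : ℕ) : ℝ) := by exact_mod_cast h1
        have h3 : (0 : ℝ) < ((max 1 (k i).natAbs : ℕ) : ℝ) := by positivity
        calc _ ≤ (2 * ((max 1 (k i).natAbs : ℕ) : ℝ)) ^ r *
              ((max 1 (k i).natAbs : ℕ) : ℝ) ^ (-r) := by gcongr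
          _ = 2 ^ r := by
              rw [Real.mul_rpow two_pos.le h3.le, mul_assoc, ← Real.rpow_add h3]
              simp
    _ = _ := by simp

/-- The half of the Littlewood–Paley description of W^r_2 needed for the lower estimate. Parseval
reduces it to single frequencies, where the block weights w satisfy w² ≤ w and sum to 1 over s. -/
theorem tsum_dyadicWeight_mul_lintegral_block_conv_le {r : ℝ} (hr : 1 / 2 < r) (α : Fin d → ℝ)
    {φ : Torus d → ℂ} (hφ : MemLp φ 2) :
    ∑' s : Fin d → ℕ, dyadicWeight (2 * r) s *
        ∫⁻ x, ‖block s (conv (bernoulliKernelMulti r α) φ) x‖ₑ ^ 2 ≤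
      ENNReal.ofReal (2 ^ r) ^ (2 * d) * ∫⁻ x, ‖φ x‖ₑ ^ 2 := by
  have hF := memLp_bernoulliKernelMulti hr α
  have hFi := hF.integrable one_le_two
  have hφi := hφ.integrable one_le_two
  have hf := (memLp_top_conv hF hφ).integrable le_top
  have hsum : ∀ k : Fin d → ℤ, ∑' s, ENNReal.ofReal (blockWeightMulti s k) = 1 := fun k => by
    rw [← ENNReal.ofReal_tsum_of_nonneg (fun s => blockWeightMulti_nonneg s k)
      (hasSum_blockWeightMulti k).summable, (hasSum_blockWeightMulti k).tsum_eq, ENNReal.ofReal_one]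
  have hterm : ∀ (s : Fin d → ℕ) (k : Fin d → ℤ), dyadicWeight (2 * r) s *
      ‖coeff (block s (conv (bernoulliKernelMulti r α) φ)) k‖ₑ ^ 2 ≤
      ENNReal.ofReal (2 ^ r) ^ (2 * d) *
        (ENNReal.ofReal (blockWeightMulti s k) * ‖coeff φ k‖ₑ ^ 2) := by
    intro s k
    rw [coeff_block s hf, coeff_conv hFi hφi, coeff_bernoulliKernelMulti hr, enorm_mul, enorm_mul]
    by_cases h0 : blockWeightMulti s k = 0
    · simp [h0]
    have h1 := dyadicWeight_mul_bernoulliCoeffMulti_le (r := r) (by linarith) α h0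
    have h2 : ‖(blockWeightMulti s k : ℂ)‖ₑ = ENNReal.ofReal (blockWeightMulti s k) := by
      rw [← ofReal_norm, Complex.norm_real, Real.norm_of_nonneg (blockWeightMulti_nonneg s k)]
    have h3 : ENNReal.ofReal (blockWeightMulti s k) ^ 2 ≤ ENNReal.ofReal (blockWeightMulti s k) :=
      pow_le_of_le_one zero_le (ENNReal.ofReal_le_one.2 (blockWeightMulti_le_one s k)) two_ne_zero
    rw [h2, two_mul r, dyadicWeight_add, pow_mul' _ 2 d]
    calc _ = (dyadicWeight r s * ‖bernoulliCoeffMulti r α k‖ₑ) ^ 2 *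
          (ENNReal.ofReal (blockWeightMulti s k) ^ 2 * ‖coeff φ k‖ₑ ^ 2) := by ring
      _ ≤ _ := by gcongr
  have hpars : ∀ s : Fin d → ℕ,
      ∫⁻ x, ‖block s (conv (bernoulliKernelMulti r α) φ) x‖ₑ ^ 2 =
        ENNReal.ofReal ((2 * Real.pi) ^ d) *
          ∑' k, ‖coeff (block s (conv (bernoulliKernelMulti r α) φ)) k‖ₑ ^ 2 := fun s =>
    parseval (memLp_of_continuous (continuous_block s hf) 2)
  simp only [hpars, parseval hφ]
  calc _ = ENNReal.ofReal ((2 * Real.pi) ^ d) * ∑' (s : Fin d → ℕ) (k : Fin d → ℤ),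
        dyadicWeight (2 * r) s *
          ‖coeff (block s (conv (bernoulliKernelMulti r α) φ)) k‖ₑ ^ 2 := by
        rw [← ENNReal.tsum_mul_left]
        refine tsum_congr fun s => ?_
        rw [ENNReal.tsum_mul_left]
        ring
    _ ≤ ENNReal.ofReal ((2 * Real.pi) ^ d) * ∑' (s : Fin d → ℕ) (k : Fin d → ℤ),
        ENNReal.ofReal (2 ^ r) ^ (2 * d) *
          (ENNReal.ofReal (blockWeightMulti s k) * ‖coeff φ k‖ₑ ^ 2) :=
        mul_le_mul_right (ENNReal.tsum_le_tsum fun s => ENNReal.tsum_le_tsum (hterm s)) _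
    _ = _ := by
        rw [ENNReal.tsum_comm]
        simp only [ENNReal.tsum_mul_left, ENNReal.tsum_mul_right, hsum, one_mul]
        ring

/-- The distribution function of `2^{r|s|_1} |A_s(f)|` with respect to `∑_s 2^{|s|_1} dx`. -/
def blockDistribution (r : ℝ) (f : Torus d → ℂ) (y : ℝ≥0∞) : ℝ≥0∞ :=
  ∑' s : Fin d → ℕ, dyadicWeight 1 s * volume {x | y < dyadicWeight r s * ‖block s f x‖ₑ}

/-- Chebyshev's inequality for the Sobolev part of a nearly optimal splitting: that part must exceed
2l wherever the weighted block of f exceeds 4l, while its φ has norm at most 2l/t. The powers of l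
cancel. -/
theorem blockDistribution_le {r₀ r₁ : ℝ} (hr₀ : 0 < r₀) (hr₁ : r₁ = r₀ + 1 / 2) (α : Fin d → ℝ)
    (f : L1 d) {t l : ℝ} (ht : 0 < t) (hl : 0 < l)
    (h : kFunctional (besovNorm r₀ ∞ ∞) (sobolevNorm r₁ α 2) t f ≤ ENNReal.ofReal l) :
    blockDistribution r₀ f (ENNReal.ofReal (4 * l)) ≤
      ENNReal.ofReal (2 ^ r₁) ^ (2 * d) * ENNReal.ofReal (t ^ (-2 : ℝ)) := by
  -- The infimum in K need not be attained; the slack from l to 2l gives an actual splitting.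
  have hlt : ENNReal.ofReal l < ENNReal.ofReal (2 * l) :=
    (ENNReal.ofReal_lt_ofReal_iff (by positivity)).2 (by linarith)
  obtain ⟨f₀, f₁, hf, hN⟩ := exists_of_kFunctional_lt (h.trans_lt hlt)
  have hN₀ : besovNorm r₀ ∞ ∞ f₀ < ENNReal.ofReal (2 * l) := le_self_add.trans_lt hN
  have hN₁ : ENNReal.ofReal t * sobolevNorm r₁ α 2 f₁ < ENNReal.ofReal (2 * l) :=
    le_add_self.trans_lt hN
  have ht0 : ENNReal.ofReal t ≠ 0 := (ENNReal.ofReal_pos.2 ht).ne'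
  rw [mul_comm, ← ENNReal.lt_div_iff_mul_lt (Or.inl ht0) (Or.inl ENNReal.ofReal_ne_top)] at hN₁
  simp only [sobolevNorm, iInf_lt_iff] at hN₁
  obtain ⟨φ, ⟨hf₁m, hf₁⟩, hφ⟩ := hN₁
  have hφm := Lp.memLp φ
  have hblock : ∀ s x, block s f x = block s f₀ x + block s f₁ x := fun s x => by
    rw [hf, block_congr_ae s (Lp.coeFn_add f₀ f₁), block_add s (L1.integrable_coeFn f₀)
      (L1.integrable_coeFn f₁)]
  rw [besovNorm] at hN₀
  split_ifs at hN₀ with hf₀m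
  swap
  · simp at hN₀
  rw [blockNorm, if_pos rfl] at hN₀
  have hb₀ : ∀ s : Fin d → ℕ, ∀ᵐ x, dyadicWeight r₀ s * ‖block s f₀ x‖ₑ ≤
      ENNReal.ofReal (2 * l) := fun s => by
    filter_upwards [enorm_ae_le_eLpNormEssSup (block s f₀) volume] with x hx
    refine le_trans ?_ ((le_iSup (fun s : Fin d → ℕ =>
      ENNReal.ofReal (2 ^ (r₀ * ((∑ i, s i : ℕ) : ℝ))) * eLpNorm (block s f₀) ∞ volume) s).trans
        hN₀.le)
    rw [eLpNorm_exponent_top]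
    exact mul_le_mul_right hx _
  have hl0 : ENNReal.ofReal (2 * l) ≠ 0 := (ENNReal.ofReal_pos.2 (by positivity)).ne'
  have hmarkov : ∀ s : Fin d → ℕ, ENNReal.ofReal (2 * l) ^ 2 *
      volume {x | ENNReal.ofReal (4 * l) < dyadicWeight r₀ s * ‖block s f x‖ₑ} ≤
      dyadicWeight (2 * r₀) s * ∫⁻ x, ‖block s f₁ x‖ₑ ^ 2 := by
    intro s
    calc _ ≤ ENNReal.ofReal (2 * l) ^ 2 *
          volume {x | ENNReal.ofReal (2 * l) ^ 2 ≤ (dyadicWeight r₀ s * ‖block s f₁ x‖ₑ) ^ 2} := by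
          refine mul_le_mul_right (measure_mono_ae ?_) _
          filter_upwards [hb₀ s] with x hx hx'
          change _ ^ 2 ≤ _ ^ 2
          change _ < _ at hx'
          refine pow_le_pow_left₀ zero_le ?_ 2
          by_contra hcon
          rw [not_le] at hcon
          refine absurd hx' (not_lt.2 ?_)
          calc dyadicWeight r₀ s * ‖block s f x‖ₑ
              ≤ dyadicWeight r₀ s * ‖block s f₀ x‖ₑ + dyadicWeight r₀ s * ‖block s f₁ x‖ₑ := by
                rw [hblock, ← mul_add]
                exact mul_le_mul_right (enorm_add_le _ _) _
            _ ≤ ENNReal.ofReal (2 * l) + ENNReal.ofReal (2 * l) := add_le_add hx hcon.le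
            _ = ENNReal.ofReal (4 * l) := by
                rw [← ENNReal.ofReal_add (by positivity) (by positivity)]
                ring_nf
      _ ≤ ∫⁻ x, (dyadicWeight r₀ s * ‖block s f₁ x‖ₑ) ^ 2 := by
          refine mul_meas_ge_le_lintegral₀ (Measurable.aemeasurable ?_) _
          exact (((continuous_block s (L1.integrable_coeFn f₁)).measurable.enorm).const_mul
            _).pow_const 2
      _ = _ := by
          simp only [mul_pow]
          rw [lintegral_const_mul' _ _ (ENNReal.pow_ne_top (dyadicWeight_ne_top _ _)),
            two_mul r₀, dyadicWeight_add, sq (dyadicWeight r₀ s)]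
  have hφ2 : ∫⁻ x, ‖φ x‖ₑ ^ 2 ≤ (ENNReal.ofReal (2 * l) / ENNReal.ofReal t) ^ 2 := by
    have h2 := eLpNorm_nnreal_pow_eq_lintegral (f := φ) (μ := volume) (p := 2) (by simp)
    simp only [NNReal.coe_ofNat, ENNReal.rpow_ofNat, ENNReal.coe_ofNat] at h2
    rw [← h2]
    exact pow_le_pow_left₀ zero_le hφ.le 2
  have hmain : ENNReal.ofReal (2 * l) ^ 2 * blockDistribution r₀ f (ENNReal.ofReal (4 * l)) ≤
      ENNReal.ofReal (2 ^ r₁) ^ (2 * d) * (ENNReal.ofReal (2 * l) / ENNReal.ofReal t) ^ 2 := by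
    rw [blockDistribution, ← ENNReal.tsum_mul_left]
    refine le_trans (ENNReal.tsum_le_tsum fun s => ?_)
      ((tsum_dyadicWeight_mul_lintegral_block_conv_le (r := r₁) (by linarith) α hφm).trans
        (mul_le_mul_right hφ2 _))
    -- Here the Sobolev weight 2^{2r₁|s|_1} splits into the density of the measure and the square of
    -- the Besov weight.
    rw [← block_congr_ae s hf₁, hr₁, show 2 * (r₀ + 1 / 2) = 1 + 2 * r₀ by ring, dyadicWeight_add,
      mul_left_comm, mul_assoc]
    exact mul_le_mul_right (hmarkov s) _
  have ht2 : ENNReal.ofReal (t ^ (-2 : ℝ)) = (ENNReal.ofReal t)⁻¹ ^ 2 := by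
    rw [Real.rpow_neg ht.le, Real.rpow_two, ENNReal.ofReal_inv_of_pos (by positivity),
      ENNReal.ofReal_pow ht.le, ENNReal.inv_pow]
  rw [ht2]
  rw [div_eq_mul_inv, mul_pow, mul_left_comm] at hmain
  exact (ENNReal.mul_le_mul_iff_right (pow_ne_zero 2 hl0)
    (ENNReal.pow_ne_top ENNReal.ofReal_ne_top)).1 hmain

/-- The layer cake formula on ℕ₀^d × 𝕋^d, with heights scaled by 4 to match `blockDistribution_le`.
-/
theorem lintegral_blockDistribution (r : ℝ) {p : ℝ} (hp : 0 < p) {f : Torus d → ℂ}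
    (hf : Integrable f) :
    blockEnergy r p f = 4 ^ p * ENNReal.ofReal p * ∫⁻ l in Set.Ioi (0 : ℝ),
      ENNReal.ofReal (l ^ (p - 1)) * blockDistribution r f (ENNReal.ofReal (4 * l)) := by
  have hp0 : ENNReal.ofReal p ≠ 0 := (ENNReal.ofReal_pos.2 hp).ne'
  have h4 : (4 : ℝ≥0∞) ^ p * ENNReal.ofReal p ≠ ∞ :=
    ENNReal.mul_ne_top (ENNReal.rpow_ne_top_of_nonneg hp.le (by norm_num)) ENNReal.ofReal_ne_top
  have hm : ∀ s : Fin d → ℕ, Measurable fun x => dyadicWeight r s * ‖block s f x‖ₑ := fun s =>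
    ((continuous_block s hf).measurable.enorm).const_mul _
  have hset : ∀ s : Fin d → ℕ, MeasurableSet {z : ℝ × Torus d |
      ENNReal.ofReal (4 * z.1) < dyadicWeight r s * ‖block s f z.2‖ₑ} := fun s =>
    measurableSet_lt (by fun_prop) ((hm s).comp measurable_snd)
  have hterm : ∀ s : Fin d → ℕ, ∫⁻ x, (dyadicWeight r s * ‖block s f x‖ₑ) ^ p =
      4 ^ p * ENNReal.ofReal p * ∫⁻ l in Set.Ioi (0 : ℝ), ENNReal.ofReal (l ^ (p - 1)) *
        volume {x | ENNReal.ofReal (4 * l) < dyadicWeight r s * ‖block s f x‖ₑ} := by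
    intro s
    have h1 : ∀ y : ℝ≥0∞, y ^ p = 4 ^ p * ENNReal.ofReal p * ∫⁻ l in Set.Ioi (0 : ℝ),
        (if ENNReal.ofReal (4 * l) < y then ENNReal.ofReal (l ^ (p - 1)) else 0) := by
      intro y
      have h2 : ∀ l : ℝ, ENNReal.ofReal (4 * l) < y ↔ ENNReal.ofReal l < y / 4 := fun l => by
        rw [ENNReal.lt_div_iff_mul_lt (Or.inl (by norm_num)) (Or.inl (by norm_num)),
          ENNReal.ofReal_mul (by norm_num), mul_comm]
        simp
      simp only [h2]
      rw [lintegral_ite_lt_rpow hp, mul_assoc, ENNReal.mul_div_cancel hp0 ENNReal.ofReal_ne_top,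
        ← ENNReal.mul_rpow_of_nonneg _ _ hp.le, ENNReal.mul_div_cancel (by norm_num) (by norm_num)]
    simp only [h1 (_ * _)]
    rw [lintegral_const_mul' _ _ h4, lintegral_lintegral_swap]
    · congr 1
      refine lintegral_congr fun l => ?_
      have h3 : MeasurableSet {x | ENNReal.ofReal (4 * l) < dyadicWeight r s * ‖block s f x‖ₑ} :=
        measurableSet_lt measurable_const (hm s)
      rw [← setLIntegral_const, ← lintegral_indicator h3]
      refine lintegral_congr fun x => ?_
      rw [Set.indicator_apply]
      exact if_congr Iff.rfl rfl rfl
    · exact (Measurable.ite (measurable_swap (hset s)) (by fun_prop)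
        measurable_const).aemeasurable
  rw [blockEnergy]
  simp only [hterm, blockDistribution]
  simp only [← ENNReal.tsum_mul_left]
  rw [lintegral_tsum, ← ENNReal.tsum_mul_left]
  · refine tsum_congr fun s => ?_
    simp only [mul_left_comm _ (dyadicWeight 1 s)]
    rw [lintegral_const_mul' _ _ (dyadicWeight_ne_top _ _)]
    ring
  · intro s
    refine Measurable.aemeasurable (Measurable.mul (by fun_prop) (Measurable.const_mul ?_ _))
    exact measurable_measure_prodMk_left (hset s)

theorem blockEnergy_le {r₀ r₁ p : ℝ} (hp : 0 < p) (hr₀ : 0 < r₀) (hr₁ : r₁ = r₀ + 1 / 2)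
    (α : Fin d → ℝ) (f : L1 d) :
    blockEnergy r₀ p f ≤ 4 ^ p * (8 * ENNReal.ofReal (2 ^ r₁) ^ (2 * d)) *
      ∫⁻ t in Set.Ioi (0 : ℝ), ENNReal.ofReal (t ^ (-3 : ℝ)) *
        kFunctional (besovNorm r₀ ∞ ∞) (sobolevNorm r₁ α 2) t f ^ p := by
  have hp0 : ENNReal.ofReal p ≠ 0 := (ENNReal.ofReal_pos.2 hp).ne'
  rw [lintegral_blockDistribution r₀ hp (L1.integrable_coeFn f)]
  have h := lintegral_rpow_mul_le_of_le_rpow_neg_two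
    (D := fun l => blockDistribution r₀ f (ENNReal.ofReal (4 * l)))
    (monotone_kFunctional (besovNorm r₀ ∞ ∞) (sobolevNorm r₁ α 2) f) hp
    (C := ENNReal.ofReal (2 ^ r₁) ^ (2 * d))
    (pow_ne_zero _ (ENNReal.ofReal_pos.2 (by positivity)).ne')
    (ENNReal.pow_ne_top ENNReal.ofReal_ne_top)
    fun t ht l hl hK => blockDistribution_le hr₀ hr₁ α f ht hl hK
  refine (mul_le_mul_right h _).trans (le_of_eq ?_)
  rw [← mul_assoc, mul_assoc (4 ^ p), ENNReal.mul_div_cancel hp0 ENNReal.ofReal_ne_top]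

/-! ## The upper estimate -/

/-- Hölder's inequality for the counting measure, with no summability to check. -/
theorem tsum_mul_sq_le {ι : Type*} [Countable ι] (a b : ι → ℝ≥0∞) :
    (∑' i, a i * b i) ^ 2 ≤ (∑' i, a i ^ 2) * ∑' i, b i ^ 2 := by
  let _ : MeasurableSpace ι := ⊤
  have h := ENNReal.lintegral_mul_le_Lp_mul_Lq (Measure.count : Measure ι)
    Real.HolderConjugate.two_two (f := a) (g := b) (measurable_of_countable a).aemeasurable
    (measurable_of_countable b).aemeasurable
  simp only [lintegral_count, Pi.mul_apply, ENNReal.rpow_ofNat] at h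
  have h2 := pow_le_pow_left₀ zero_le h 2
  have hsqrt : ∀ x : ℝ≥0∞, (x ^ (1 / 2 : ℝ)) ^ 2 = x := fun x => by
    rw [← ENNReal.rpow_two, ← ENNReal.rpow_mul]
    norm_num
  rwa [mul_pow, hsqrt, hsqrt] at h2

/-- The summable uniform bounds allow integration term by term on a space of finite measure. -/
theorem hasSum_coeff {ι : Type*} [Countable ι] {u : ι → Torus d → ℂ} (hu : ∀ i, Continuous (u i))
    {M : ι → ℝ} (hM : Summable M) (hb : ∀ i x, ‖u i x‖ ≤ M i) (k : Fin d → ℤ) :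
    HasSum (fun i => coeff (u i) k) (coeff (fun x => ∑' i, u i x) k) := by
  have h : HasSum (fun i => ∫ y, character (-k) y * u i y)
      (∫ y, ∑' i, character (-k) y * u i y) := by
    refine hasSum_integral_of_summable_integral_norm
      (fun i => integrable_character_mul (integrable_of_continuous (hu i)) _) ?_
    refine Summable.of_nonneg_of_le (fun i => integral_nonneg fun y => norm_nonneg _) (fun i => ?_)
      (hM.mul_left ((volume : Measure (Torus d)).real Set.univ))
    calc ∫ y, ‖character (-k) y * u i y‖ ≤ ∫ _y : Torus d, M i := by
          refine integral_mono_of_nonneg (Filter.Eventually.of_forall fun y => norm_nonneg _)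
            (integrable_const _) (Filter.Eventually.of_forall fun y => ?_)
          simpa using hb i y
      _ = _ := by simp
  simp only [tsum_mul_left] at h
  exact h.const_smul _

theorem hasSum_block {ι : Type*} [Countable ι] {u : ι → Torus d → ℂ} (hu : ∀ i, Continuous (u i))
    {M : ι → ℝ} (hM : Summable M) (hb : ∀ i x, ‖u i x‖ ≤ M i)
    (hc : Continuous fun x => ∑' i, u i x) (s : Fin d → ℕ) (x : Torus d) :
    HasSum (fun i => block s (u i) x) (block s (fun x => ∑' i, u i x) x) := by
  rw [block_eq s (integrable_of_continuous hc)]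
  simp only [fun i => block_eq s (integrable_of_continuous (hu i))]
  exact hasSum_sum fun k _ => ((hasSum_coeff hu hM hb k).mul_left _).mul_right _

/-! ### Truncated blocks and the bounded part -/

/-- The values of modulus at most `M` of a function, the others being replaced by zero. -/
def lowPart (M : ℝ) (g : Torus d → ℂ) (x : Torus d) : ℂ := if ‖g x‖ ≤ M then g x else 0

theorem norm_lowPart_le {M : ℝ} (hM : 0 ≤ M) (g : Torus d → ℂ) (x : Torus d) :
    ‖lowPart M g x‖ ≤ M := by
  unfold lowPart
  split_ifs with h
  · exact h
  · simpa using hM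

theorem memLp_lowPart {M : ℝ} (hM : 0 ≤ M) {g : Torus d → ℂ} (hg : Continuous g) (p : ℝ≥0∞) :
    MemLp (lowPart M g) p volume := by
  have hm : Measurable (lowPart M g) :=
    Measurable.ite (measurableSet_le hg.norm.measurable measurable_const) hg.measurable
      measurable_const
  exact MemLp.mono_exponent (memLp_top_of_bound hm.aestronglyMeasurable M
    (Filter.Eventually.of_forall (norm_lowPart_le hM g))) le_top

/-- The truncation level for the block `A_s(f)`. -/
def level (r l : ℝ) (s : Fin d → ℕ) : ℝ := l * 2 ^ (-r * ((∑ i, s i : ℕ) : ℝ))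

theorem level_nonneg (r : ℝ) {l : ℝ} (hl : 0 ≤ l) (s : Fin d → ℕ) : 0 ≤ level r l s :=
  mul_nonneg hl (by positivity)

theorem ofReal_level (r : ℝ) {l : ℝ} (hl : 0 ≤ l) (s : Fin d → ℕ) :
    ENNReal.ofReal (level r l s) = ENNReal.ofReal l * dyadicWeight (-r) s :=
  ENNReal.ofReal_mul hl

theorem summable_level {r : ℝ} (hr : 0 < r) (l : ℝ) :
    Summable fun s : Fin d → ℕ => level r l s := by
  have h := ENNReal.summable_toReal (tsum_dyadicWeight_neg_ne_top (d := d) hr)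
  refine (h.mul_left l).congr fun s => ?_
  rw [dyadicWeight, ENNReal.toReal_ofReal (by positivity), level]

/-- The bounded part in the decomposition of `f` at the height `l`. -/
def boundedPart (r l : ℝ) (f : Torus d → ℂ) (x : Torus d) : ℂ :=
  ∑' s : Fin d → ℕ, conv (smoothKernel s) (lowPart (level r l s) (block s f)) x

section BoundedPart

variable {r l : ℝ} {f : Torus d → ℂ}

theorem integrable_lowPart_block (hl : 0 < l) (hf : Integrable f) (s : Fin d → ℕ) :
    Integrable (lowPart (level r l s) (block s f)) :=
  (memLp_lowPart (level_nonneg r hl.le s) (continuous_block s hf) 1).integrable le_rfl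

theorem norm_conv_lowPart_le (hl : 0 < l) (s : Fin d → ℕ) (x : Torus d) :
    ‖conv (smoothKernel s) (lowPart (level r l s) (block s f)) x‖ ≤ 3 ^ d * level r l s :=
  norm_conv_smoothKernel_le s (level_nonneg r hl.le s)
    (norm_lowPart_le (level_nonneg r hl.le s) _) x

/-- The Weierstrass test: for r > 0 the truncation levels are summable over s. -/
theorem continuous_boundedPart (hr : 0 < r) (hl : 0 < l) (hf : Integrable f) :
    Continuous (boundedPart r l f) :=
  continuous_tsum (fun s => continuous_conv_smoothKernel s (integrable_lowPart_block hl hf s))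
    ((summable_level hr l).mul_left (3 ^ d)) fun s x => norm_conv_lowPart_le hl s x

-- Pieces s' with some s_i > s'_i + 2 have spectrum disjoint from that of A_s. Each other piece
-- costs 6^d for the block kernel and 3^d for the smoothing kernel, times its truncation level.
open Classical in
theorem enorm_block_boundedPart_le (hr : 0 < r) (hl : 0 < l) (hf : Integrable f)
    (s : Fin d → ℕ) (x : Torus d) :
    ‖block s (boundedPart r l f) x‖ₑ ≤ 18 ^ d * ENNReal.ofReal l *
      ∑' s' : Fin d → ℕ, (if ∀ i, s i ≤ s' i + 2 then dyadicWeight (-r) s' else 0) := by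
  have hu : ∀ s', Continuous (conv (smoothKernel s') (lowPart (level r l s') (block s' f))) :=
    fun s' => continuous_conv_smoothKernel s' (integrable_lowPart_block hl hf s')
  have h := hasSum_block hu ((summable_level hr l).mul_left (3 ^ d))
    (fun s x => norm_conv_lowPart_le hl s x) (continuous_boundedPart hr hl hf) s x
  change HasSum _ (block s (boundedPart r l f) x) at h
  rw [← h.tsum_eq, ← ENNReal.tsum_mul_left]
  refine enorm_tsum_le_tsum_enorm.trans (ENNReal.tsum_le_tsum fun s' => ?_)
  split_ifs with hs
  · have h1 := norm_block_le s (M := 3 ^ d * level r l s')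
      (mul_nonneg (by positivity) (level_nonneg r hl.le s'))
      (fun y => norm_conv_lowPart_le (r := r) (f := f) hl s' y) x
    rw [← ofReal_norm, mul_assoc, ← ofReal_level r hl.le]
    refine (ENNReal.ofReal_le_ofReal h1).trans (le_of_eq ?_)
    rw [← mul_assoc, ← mul_pow, ENNReal.ofReal_mul (by positivity),
      ENNReal.ofReal_pow (by norm_num)]
    norm_num
  · have h0 : block s (conv (smoothKernel s') (lowPart (level r l s') (block s' f))) x = 0 := by
      rw [block_eq s (integrable_of_continuous (hu s'))]
      refine Finset.sum_eq_zero fun k _ => ?_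
      have h2 : blockWeightMulti s k * smoothWeight s' k = 0 := by
        by_contra hne
        exact hs (le_of_blockWeightMulti_mul_smoothWeight_ne_zero hne)
      rw [coeff_conv_smoothKernel s' (integrable_lowPart_block hl hf s'), ← mul_assoc,
        ← Complex.ofReal_mul, h2]
      simp
    simp [h0]

theorem blockNorm_boundedPart_le (hr : 0 < r) (hl : 0 < l) (hf : Integrable f) :
    blockNorm r ∞ ∞ (boundedPart r l f) ≤ 18 ^ d * ENNReal.ofReal (2 ^ (r * (2 * d))) *
      (∑' s : Fin d → ℕ, dyadicWeight (-r) s) * ENNReal.ofReal l := by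
  classical
  rw [blockNorm, if_pos rfl]
  refine iSup_le fun s => ?_
  rw [eLpNorm_exponent_top]
  change dyadicWeight r s * _ ≤ _
  calc _ ≤ dyadicWeight r s * (18 ^ d * ENNReal.ofReal l *
        (ENNReal.ofReal (2 ^ (r * (2 * d))) * dyadicWeight (-r) s *
          ∑' n : Fin d → ℕ, dyadicWeight (-r) n)) := by
        refine mul_le_mul_right (eLpNormEssSup_le_of_ae_enorm_bound
          (Filter.Eventually.of_forall fun x => ?_)) _
        exact (enorm_block_boundedPart_le hr hl hf s x).trans
          (mul_le_mul_right (tsum_dyadicWeight_neg_le r s) _)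
    _ = (dyadicWeight r s * dyadicWeight (-r) s) * (18 ^ d * ENNReal.ofReal (2 ^ (r * (2 * d))) *
          (∑' s : Fin d → ℕ, dyadicWeight (-r) s) * ENNReal.ofReal l) := by ring
    _ = _ := by rw [dyadicWeight_mul_neg, one_mul]

/-- The block weights sum to 1 and smoothing fixes each A_s(f), so at the level of coefficients the
remainder is the sum of the smoothed parts above the truncation level. -/
theorem hasSum_coeff_sub_boundedPart (hr : 0 < r) (hl : 0 < l) (hf : Integrable f)
    (k : Fin d → ℤ) :
    HasSum (fun s => (smoothWeight s k : ℂ) *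
      coeff (fun x => block s f x - lowPart (level r l s) (block s f) x) k)
      (coeff f k - coeff (boundedPart r l f) k) := by
  have h1 := hasSum_coeff (fun s => continuous_conv_smoothKernel s (integrable_lowPart_block hl hf s))
    ((summable_level hr l).mul_left (3 ^ d)) (fun s x => norm_conv_lowPart_le hl s x) k
  have h2 : HasSum (fun s => (blockWeightMulti s k : ℂ) * coeff f k) (1 * coeff f k) := by
    refine HasSum.mul_right _ ?_
    have h3 := Complex.hasSum_ofReal.2 (hasSum_blockWeightMulti k)
    rwa [Complex.ofReal_one] at h3
  rw [one_mul] at h2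
  refine (h2.sub h1).congr_fun fun s => ?_
  rw [coeff_sub (integrable_of_continuous (continuous_block s hf))
    (integrable_lowPart_block hl hf s), coeff_block s hf,
    coeff_conv_smoothKernel s (integrable_lowPart_block hl hf s), mul_sub, ← mul_assoc,
    ← Complex.ofReal_mul, smoothWeight_mul_blockWeightMulti]

end BoundedPart

/-! ### The Sobolev part and the K-functional -/

/-- The binary length is the right index: |k_i| < 2^{s_i+2} holds exactly when it is at most s_i +
2, the range in `tsum_dyadicWeight_neg_le`. -/
theorem inv_enorm_bernoulliCoeffMulti_le {r : ℝ} (hr : 0 ≤ r) (α : Fin d → ℝ) (k : Fin d → ℤ) :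
    ‖(bernoulliCoeffMulti r α k)⁻¹‖ₑ ≤ dyadicWeight r fun i => (k i).natAbs.size := by
  rw [← ofReal_norm, norm_inv, norm_bernoulliCoeffMulti, dyadicWeight, two_rpow_mul_sum,
    ← Finset.prod_inv_distrib]
  refine ENNReal.ofReal_le_ofReal (Finset.prod_le_prod (fun i _ => by positivity) fun i _ => ?_)
  rw [Real.rpow_neg (by positivity), inv_inv]
  refine Real.rpow_le_rpow (by positivity) ?_ hr
  have h1 : (k i).natAbs < 2 ^ (k i).natAbs.size := Nat.lt_size_self _
  have h2 := Nat.one_le_two_pow (n := (k i).natAbs.size)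
  exact_mod_cast max_le h2 h1.le

/-- The part of `∑_s 2^{|s|_1} ∫ (2^{r|s|_1} |A_s(f)|)^2` that comes from the values above `y`. -/
def highEnergy (r : ℝ) (f : Torus d → ℂ) (y : ℝ≥0∞) : ℝ≥0∞ :=
  ∑' s : Fin d → ℕ, dyadicWeight 1 s *
    ∫⁻ x, if y < dyadicWeight r s * ‖block s f x‖ₑ then
      (dyadicWeight r s * ‖block s f x‖ₑ) ^ 2 else 0

theorem highEnergy_eq (r : ℝ) (f : Torus d → ℂ) {l : ℝ} (hl : 0 < l) :
    highEnergy r f (ENNReal.ofReal l) = ∑' s : Fin d → ℕ, dyadicWeight (2 * (r + 1 / 2)) s *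
      ∫⁻ x, ‖block s f x - lowPart (level r l s) (block s f) x‖ₑ ^ 2 := by
  refine tsum_congr fun s => ?_
  have h : ∀ x, (if ENNReal.ofReal l < dyadicWeight r s * ‖block s f x‖ₑ then
      (dyadicWeight r s * ‖block s f x‖ₑ) ^ 2 else 0) =
      dyadicWeight (2 * r) s *
        ‖block s f x - lowPart (level r l s) (block s f) x‖ₑ ^ 2 := by
    intro x
    have h1 : ENNReal.ofReal l < dyadicWeight r s * ‖block s f x‖ₑ ↔
        ¬ ‖block s f x‖ ≤ level r l s := by
      rw [← not_le, not_iff_not, ← ENNReal.ofReal_le_ofReal_iff (level_nonneg r hl.le s),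
        ofReal_norm, ofReal_level r hl.le]
      constructor
      · intro h2
        calc ‖block s f x‖ₑ = (dyadicWeight r s * dyadicWeight (-r) s) * ‖block s f x‖ₑ := by
              rw [dyadicWeight_mul_neg, one_mul]
          _ = (dyadicWeight r s * ‖block s f x‖ₑ) * dyadicWeight (-r) s := by ring
          _ ≤ _ := mul_le_mul_left h2 _
      · intro h2
        calc _ ≤ dyadicWeight r s * (ENNReal.ofReal l * dyadicWeight (-r) s) :=
              mul_le_mul_right h2 _
          _ = (dyadicWeight r s * dyadicWeight (-r) s) * ENNReal.ofReal l := by ring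
          _ = _ := by rw [dyadicWeight_mul_neg, one_mul]
    rw [lowPart]
    by_cases h2 : ‖block s f x‖ ≤ level r l s
    · rw [if_neg (fun h3 => h1.1 h3 h2), if_pos h2]
      simp
    · rw [if_pos (h1.2 h2), if_neg h2, sub_zero, mul_pow, two_mul r, dyadicWeight_add, sq]
  simp only [h]
  rw [lintegral_const_mul' _ _ (dyadicWeight_ne_top _ _), ← mul_assoc, ← dyadicWeight_add]
  congr 2
  ring

/-- The constant in the estimate of the part of `f` above the height `l`. -/
def highConst (d : ℕ) (r : ℝ) : ℝ≥0∞ :=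
  ENNReal.ofReal (2 ^ (2 * r * (2 * d))) * ∑' s : Fin d → ℕ, dyadicWeight (-(2 * r)) s

theorem highConst_ne_top (d : ℕ) {r : ℝ} (hr : 0 < r) : highConst d r ≠ ∞ :=
  ENNReal.mul_ne_top ENNReal.ofReal_ne_top (tsum_dyadicWeight_neg_ne_top (by positivity))

/-- If the coefficients of the `c_s` are summed with the weights of the smoothing kernels, the
result, divided by the coefficients of the Bernoulli kernel, is controlled in `ℓ_2`. -/
theorem enorm_sq_div_bernoulliCoeffMulti_le {r : ℝ} (hr : 0 ≤ r) (α : Fin d → ℝ)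
    (k : Fin d → ℤ) {c : (Fin d → ℕ) → ℂ} {z : ℂ}
    (h : HasSum (fun s => (smoothWeight s k : ℂ) * c s) z) :
    ‖(bernoulliCoeffMulti r α k)⁻¹ * z‖ₑ ^ 2 ≤
      highConst d r * ∑' s, dyadicWeight (2 * r) s * ‖c s‖ₑ ^ 2 := by
  classical
  set S : Fin d → ℕ := fun i => (k i).natAbs.size with hS
  -- Inserting 2^{-r|s|_1} 2^{r|s|_1} prepares Cauchy–Schwarz: the first factors, squared, sum to
  -- about 2^{-2r|S|_1}, which cancels the square of the inverse Bernoulli coefficient.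
  have h1 : ‖z‖ₑ ≤ ∑' s : Fin d → ℕ, (if ∀ i, S i ≤ s i + 2 then dyadicWeight (-r) s else 0) *
      (dyadicWeight r s * ‖c s‖ₑ) := by
    rw [← h.tsum_eq]
    refine enorm_tsum_le_tsum_enorm.trans (ENNReal.tsum_le_tsum fun s => ?_)
    split_ifs with hs
    · rw [← mul_assoc, mul_comm (dyadicWeight (-r) s), dyadicWeight_mul_neg, one_mul, enorm_mul]
      refine mul_le_of_le_one_left zero_le ?_
      rw [← ofReal_norm, Complex.norm_real, Real.norm_of_nonneg (smoothWeight_nonneg s k)]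
      exact ENNReal.ofReal_le_one.2 (smoothWeight_le_one s k)
    · have h0 : smoothWeight s k = 0 := by
        by_contra hne
        exact hs fun i => Nat.size_le.2 (natAbs_lt_of_smoothWeight_ne_zero hne i)
      simp [h0]
  have h2 : ∀ s : Fin d → ℕ, (if ∀ i, S i ≤ s i + 2 then dyadicWeight (-r) s else 0) ^ 2 =
      if ∀ i, S i ≤ s i + 2 then dyadicWeight (-(2 * r)) s else 0 := fun s => by
    split_ifs
    · rw [show -(2 * r) = -r + -r by ring, dyadicWeight_add, sq]
    · simp
  have h3 : ∀ s : Fin d → ℕ, (dyadicWeight r s * ‖c s‖ₑ) ^ 2 =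
      dyadicWeight (2 * r) s * ‖c s‖ₑ ^ 2 := fun s => by
    rw [mul_pow, two_mul r, dyadicWeight_add, sq (dyadicWeight r s)]
  have h4 := (pow_le_pow_left₀ zero_le h1 2).trans (tsum_mul_sq_le _ _)
  simp only [h2, h3] at h4
  rw [enorm_mul, mul_pow]
  calc _ ≤ dyadicWeight r S ^ 2 * ((ENNReal.ofReal (2 ^ (2 * r * (2 * d))) *
        dyadicWeight (-(2 * r)) S * ∑' n : Fin d → ℕ, dyadicWeight (-(2 * r)) n) *
        ∑' s, dyadicWeight (2 * r) s * ‖c s‖ₑ ^ 2) := by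
        refine mul_le_mul' (pow_le_pow_left₀ zero_le
          (inv_enorm_bernoulliCoeffMulti_le hr α k) 2) (h4.trans ?_)
        exact mul_le_mul_left (tsum_dyadicWeight_neg_le (2 * r) S) _
    _ = (dyadicWeight (2 * r) S * dyadicWeight (-(2 * r)) S) * (highConst d r *
          ∑' s, dyadicWeight (2 * r) s * ‖c s‖ₑ ^ 2) := by
        rw [highConst, two_mul r, dyadicWeight_add]
        ring
    _ = _ := by rw [dyadicWeight_mul_neg, one_mul]

/-- Dividing the coefficients of the remainder by those of the Bernoulli kernel gives a square
summable family, and Riesz–Fischer turns it into φ. Uniqueness of Fourier coefficients in L_2 gives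
the representation, which is why f is taken in L_2. -/
theorem exists_sub_boundedPart_eq_conv {r₀ r₁ l : ℝ} (hr₀ : 0 < r₀) (hr₁ : r₁ = r₀ + 1 / 2)
    (α : Fin d → ℝ) (hl : 0 < l) {f : Torus d → ℂ} (hf : MemLp f 2)
    (hfin : highEnergy r₀ f (ENNReal.ofReal l) ≠ ∞) :
    ∃ φ : Lp ℂ 2 (volume : Measure (Torus d)),
      (fun x => f x - boundedPart r₀ l f x) =ᵐ[volume] conv (bernoulliKernelMulti r₁ α) φ ∧
      ∫⁻ x, ‖φ x‖ₑ ^ 2 ≤ highConst d r₁ * highEnergy r₀ f (ENNReal.ofReal l) := by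
  have hfi := hf.integrable one_le_two
  have hr₁' : 1 / 2 < r₁ := by linarith
  have hg := memLp_of_continuous (continuous_boundedPart hr₀ hl hfi) 2
  have hgi := hg.integrable one_le_two
  set c : (Fin d → ℕ) → Torus d → ℂ :=
    fun s x => block s f x - lowPart (level r₀ l s) (block s f) x with hc
  have hcm : ∀ s, MemLp (c s) 2 := fun s =>
    (memLp_of_continuous (continuous_block s hfi) 2).sub
      (memLp_lowPart (level_nonneg r₀ hl.le s) (continuous_block s hfi) 2)
  set a : (Fin d → ℤ) → ℂ := fun k =>
    (bernoulliCoeffMulti r₁ α k)⁻¹ * (coeff f k - coeff (boundedPart r₀ l f) k) with ha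
  have hpos : ENNReal.ofReal ((2 * Real.pi) ^ d) ≠ 0 :=
    (ENNReal.ofReal_pos.2 (two_pi_pow_pos d)).ne'
  have hbound : ENNReal.ofReal ((2 * Real.pi) ^ d) * ∑' k, ‖a k‖ₑ ^ 2 ≤
      highConst d r₁ * highEnergy r₀ f (ENNReal.ofReal l) := by
    calc _ ≤ ENNReal.ofReal ((2 * Real.pi) ^ d) * ∑' k, highConst d r₁ *
          ∑' s, dyadicWeight (2 * r₁) s * ‖coeff (c s) k‖ₑ ^ 2 :=
          mul_le_mul_right (ENNReal.tsum_le_tsum fun k =>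
            enorm_sq_div_bernoulliCoeffMulti_le (by linarith) α k
              (hasSum_coeff_sub_boundedPart hr₀ hl hfi k)) _
      _ = highConst d r₁ * ∑' s, dyadicWeight (2 * r₁) s *
          (ENNReal.ofReal ((2 * Real.pi) ^ d) * ∑' k, ‖coeff (c s) k‖ₑ ^ 2) := by
          rw [ENNReal.tsum_mul_left, ENNReal.tsum_comm, mul_left_comm, ← ENNReal.tsum_mul_left]
          congr 1
          refine tsum_congr fun s => ?_
          rw [ENNReal.tsum_mul_left]
          ring
      _ = _ := by
          rw [highEnergy_eq r₀ f hl, ← hr₁]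
          simp only [fun s => (parseval (hcm s)).symm]
          rfl
  have hfin' : ∑' k, ‖a k‖ₑ ^ 2 ≠ ∞ := by
    intro htop
    rw [htop, ENNReal.mul_top hpos, top_le_iff] at hbound
    exact ENNReal.mul_ne_top (highConst_ne_top d (by linarith)) hfin hbound
  obtain ⟨φ, hφ⟩ := exists_coeff_eq hfin'
  refine ⟨φ, ?_, ?_⟩
  · have hF := memLp_bernoulliKernelMulti hr₁' α
    have hφm := Lp.memLp φ
    refine ae_eq_of_coeff_eq (hf.sub hg) ((memLp_top_conv hF hφm).mono_exponent le_top) fun k => ?_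
    rw [coeff_conv (hF.integrable one_le_two) (hφm.integrable one_le_two),
      coeff_bernoulliKernelMulti hr₁', hφ, ha,
      mul_inv_cancel_left₀ (bernoulliCoeffMulti_ne_zero r₁ α k)]
    exact coeff_sub hfi hgi k
  · rw [parseval (Lp.memLp φ)]
    simp only [hφ]
    exact hbound

/-- The constant in the estimate of the bounded part. -/
def lowConst (d : ℕ) (r : ℝ) : ℝ≥0∞ :=
  18 ^ d * ENNReal.ofReal (2 ^ (r * (2 * d))) * ∑' s : Fin d → ℕ, dyadicWeight (-r) s

theorem lowConst_ne_top (d : ℕ) {r : ℝ} (hr : 0 < r) : lowConst d r ≠ ∞ :=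
  ENNReal.mul_ne_top (ENNReal.mul_ne_top (ENNReal.pow_ne_top (by norm_num)) ENNReal.ofReal_ne_top)
    (tsum_dyadicWeight_neg_ne_top hr)

/-- The hypothesis is the balance between the two parts: t times the Sobolev norm of the remainder
is at most the root of a constant times t² `highEnergy`, hence of the order l, like the Besov norm
of the bounded part. -/
theorem kFunctional_le {r₀ r₁ : ℝ} (hr₀ : 0 < r₀) (hr₁ : r₁ = r₀ + 1 / 2)
    (α : Fin d → ℝ) {f : L1 d} (hf : MemLp f 2 volume) {t l : ℝ} (ht : 0 < t) (hl : 0 < l)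
    (h : ENNReal.ofReal (t ^ 2) * highEnergy r₀ f (ENNReal.ofReal l) ≤ ENNReal.ofReal (l ^ 2)) :
    kFunctional (besovNorm r₀ ∞ ∞) (sobolevNorm r₁ α 2) t f ≤
      (lowConst d r₀ + highConst d r₁ ^ (1 / 2 : ℝ)) * ENNReal.ofReal l := by
  have ht0 : ENNReal.ofReal (t ^ 2) ≠ 0 := (ENNReal.ofReal_pos.2 (by positivity)).ne'
  have hfin : highEnergy r₀ f (ENNReal.ofReal l) ≠ ∞ := by
    intro htop
    rw [htop, ENNReal.mul_top ht0, top_le_iff] at h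
    exact ENNReal.ofReal_ne_top h
  have hfi := L1.integrable_coeFn f
  have hcont := continuous_boundedPart hr₀ hl hfi
  obtain ⟨φ, hφ, hφn⟩ := exists_sub_boundedPart_eq_conv hr₀ hr₁ α hl hf hfin
  have hg1 := memLp_of_continuous hcont 1
  set g : L1 d := hg1.toLp _
  have hg : g =ᵐ[volume] boundedPart r₀ l f := hg1.coeFn_toLp
  have hfg : (f - g : L1 d) =ᵐ[volume] fun x => f x - boundedPart r₀ l f x := by
    filter_upwards [Lp.coeFn_sub f g, hg] with x hx hx'
    rw [hx, Pi.sub_apply, hx']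
  have hN₀ : besovNorm r₀ ∞ ∞ g ≤ lowConst d r₀ * ENNReal.ofReal l := by
    rw [besovNorm, if_pos ((memLp_congr_ae hg).2 (memLp_of_continuous hcont ∞))]
    have : blockNorm r₀ ∞ ∞ g = blockNorm r₀ ∞ ∞ (boundedPart r₀ l f) := by
      simp only [blockNorm, block_congr_ae _ hg]
    rw [this]
    exact blockNorm_boundedPart_le hr₀ hl hfi
  have hN₁ : sobolevNorm r₁ α 2 (f - g) ≤
      (highConst d r₁ * highEnergy r₀ f (ENNReal.ofReal l)) ^ (1 / 2 : ℝ) := by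
    refine (iInf₂_le φ ⟨(memLp_congr_ae hfg).2 (hf.sub (memLp_of_continuous hcont 2)),
      hfg.trans hφ⟩).trans ?_
    rw [eLpNorm_eq_lintegral_rpow_enorm_toReal two_ne_zero ENNReal.ofNat_ne_top]
    simp only [ENNReal.toReal_ofNat, ENNReal.rpow_ofNat]
    exact ENNReal.rpow_le_rpow hφn (by norm_num)
  have hsqrt : ∀ y : ℝ, 0 ≤ y → ENNReal.ofReal (y ^ 2) ^ (1 / 2 : ℝ) = ENNReal.ofReal y := by
    intro y hy
    rw [ENNReal.ofReal_rpow_of_nonneg (by positivity) (by norm_num), ← Real.sqrt_eq_rpow,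
      Real.sqrt_sq hy]
  have htN₁ : ENNReal.ofReal t * sobolevNorm r₁ α 2 (f - g) ≤
      highConst d r₁ ^ (1 / 2 : ℝ) * ENNReal.ofReal l := by
    calc _ ≤ ENNReal.ofReal (t ^ 2) ^ (1 / 2 : ℝ) *
          (highConst d r₁ * highEnergy r₀ f (ENNReal.ofReal l)) ^ (1 / 2 : ℝ) := by
          rw [hsqrt t ht.le]
          exact mul_le_mul_right hN₁ _
      _ = (highConst d r₁ * (ENNReal.ofReal (t ^ 2) *
          highEnergy r₀ f (ENNReal.ofReal l))) ^ (1 / 2 : ℝ) := by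
          rw [← ENNReal.mul_rpow_of_nonneg _ _ (by norm_num)]
          congr 1
          ring
      _ ≤ (highConst d r₁ * ENNReal.ofReal (l ^ 2)) ^ (1 / 2 : ℝ) :=
          ENNReal.rpow_le_rpow (mul_le_mul_right h _) (by norm_num)
      _ = _ := by rw [ENNReal.mul_rpow_of_nonneg _ _ (by norm_num), hsqrt l hl.le]
  refine (iInf_le_of_le g (iInf_le_of_le (f - g)
    (iInf_le_of_le (add_sub_cancel g f).symm le_rfl))).trans ?_
  rw [add_mul]
  exact add_le_add hN₀ htN₁

/-- By Fubini, F² is multiplied by the integral of l^{p-3} over 0 < l < F, which is F^{p-2}/(p-2)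
since p > 2. -/
theorem lintegral_highEnergy (r : ℝ) {p : ℝ} (hp : 2 < p) {f : Torus d → ℂ} (hf : Integrable f) :
    ∫⁻ l in Set.Ioi (0 : ℝ), ENNReal.ofReal (l ^ (p - 3)) *
      highEnergy r f (ENNReal.ofReal l) = blockEnergy r p f / ENNReal.ofReal (p - 2) := by
  have hm : ∀ s : Fin d → ℕ, Measurable fun x => dyadicWeight r s * ‖block s f x‖ₑ := fun s =>
    ((continuous_block s hf).measurable.enorm).const_mul _
  have hm2 : ∀ s : Fin d → ℕ, Measurable fun z : ℝ × Torus d =>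
      if ENNReal.ofReal z.1 < dyadicWeight r s * ‖block s f z.2‖ₑ then
        (dyadicWeight r s * ‖block s f z.2‖ₑ) ^ 2 else 0 := fun s =>
    Measurable.ite (measurableSet_lt (by fun_prop) ((hm s).comp measurable_snd))
      (((hm s).comp measurable_snd).pow_const 2) measurable_const
  have hterm : ∀ s : Fin d → ℕ, ∫⁻ l in Set.Ioi (0 : ℝ), ENNReal.ofReal (l ^ (p - 3)) *
      ∫⁻ x, (if ENNReal.ofReal l < dyadicWeight r s * ‖block s f x‖ₑ then
        (dyadicWeight r s * ‖block s f x‖ₑ) ^ 2 else 0) =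
      (∫⁻ x, (dyadicWeight r s * ‖block s f x‖ₑ) ^ p) / ENNReal.ofReal (p - 2) := by
    intro s
    simp only [← lintegral_const_mul' _ _ ENNReal.ofReal_ne_top]
    rw [lintegral_lintegral_swap]
    · rw [div_eq_mul_inv, ← lintegral_mul_const' _ _
        (ENNReal.inv_ne_top.2 (ENNReal.ofReal_pos.2 (sub_pos.2 hp)).ne')]
      refine lintegral_congr fun x => ?_
      have hne : dyadicWeight r s * ‖block s f x‖ₑ ≠ ∞ :=
        ENNReal.mul_ne_top (dyadicWeight_ne_top _ _) enorm_ne_top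
      generalize dyadicWeight r s * ‖block s f x‖ₑ = y at hne
      calc _ = ∫⁻ l in Set.Ioi (0 : ℝ), y ^ 2 *
            (if ENNReal.ofReal l < y then ENNReal.ofReal (l ^ (p - 2 - 1)) else 0) := by
            refine lintegral_congr fun l => ?_
            rw [show p - 2 - 1 = p - 3 by ring]
            split_ifs
            · exact mul_comm _ _
            · simp
        _ = _ := by
            rw [lintegral_const_mul' _ _ (ENNReal.pow_ne_top hne),
              lintegral_ite_lt_rpow (sub_pos.2 hp), div_eq_mul_inv, ← mul_assoc,
              ← ENNReal.rpow_two, ← ENNReal.rpow_add_of_nonneg _ _ (by norm_num) (by linarith),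
              add_sub_cancel]
    · exact (Measurable.mul (by fun_prop) (hm2 s)).aemeasurable
  simp only [highEnergy, ← ENNReal.tsum_mul_left]
  rw [lintegral_tsum]
  · rw [blockEnergy, div_eq_mul_inv, ← ENNReal.tsum_mul_right]
    refine tsum_congr fun s => ?_
    simp only [mul_left_comm _ (dyadicWeight 1 s)]
    rw [lintegral_const_mul' _ _ (dyadicWeight_ne_top _ _), hterm, div_eq_mul_inv, mul_assoc]
  · intro s
    refine Measurable.aemeasurable (Measurable.mul (by fun_prop) (Measurable.const_mul ?_ _))
    exact (hm2 s).lintegral_prod_right'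

theorem lintegral_kFunctional_le {r₀ r₁ p : ℝ} (hp : 2 < p) (hr₀ : 0 < r₀)
    (hr₁ : r₁ = r₀ + 1 / 2) (α : Fin d → ℝ) {f : L1 d} (hf : MemLp f 2 volume) :
    ∫⁻ t in Set.Ioi (0 : ℝ), ENNReal.ofReal (t ^ (-3 : ℝ)) *
        kFunctional (besovNorm r₀ ∞ ∞) (sobolevNorm r₁ α 2) t f ^ p ≤
      (lowConst d r₀ + highConst d r₁ ^ (1 / 2 : ℝ) + 1) ^ p * ENNReal.ofReal p /
        ENNReal.ofReal (p - 2) * blockEnergy r₀ p f := by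
  -- The summand 1 makes the constant visibly nonzero, as the integral inequality requires.
  have hC : lowConst d r₀ + highConst d r₁ ^ (1 / 2 : ℝ) + 1 ≠ ∞ := by
    have := lowConst_ne_top d hr₀
    have := ENNReal.rpow_ne_top_of_nonneg (y := 1 / 2) (by norm_num)
      (highConst_ne_top d (r := r₁) (by linarith))
    finiteness
  have hcoe := ENNReal.coe_toNNReal hC
  have hK : ∀ t > 0, ∀ l > 0,
      ENNReal.ofReal (t ^ 2) * highEnergy r₀ f (ENNReal.ofReal l) ≤ ENNReal.ofReal (l ^ 2) →
      kFunctional (besovNorm r₀ ∞ ∞) (sobolevNorm r₁ α 2) t f ≤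
        (lowConst d r₀ + highConst d r₁ ^ (1 / 2 : ℝ) + 1).toNNReal * ENNReal.ofReal l := by
    intro t ht l hl h
    rw [hcoe]
    exact (kFunctional_le hr₀ hr₁ α hf ht hl h).trans (mul_le_mul_left le_self_add _)
  have hne : (lowConst d r₀ + highConst d r₁ ^ (1 / 2 : ℝ) + 1).toNNReal ≠ 0 := by
    rw [← ENNReal.coe_ne_zero, hcoe]
    simp
  have h := lintegral_rpow_le_of_le_of_sq_mul_le
    (φ := fun l => highEnergy r₀ f (ENNReal.ofReal l))
    (monotone_kFunctional _ _ f).measurable (p := p) (by linarith) hne hK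
  rw [lintegral_highEnergy r₀ hp (L1.integrable_coeFn f), hcoe] at h
  refine h.trans (le_of_eq ?_)
  simp only [div_eq_mul_inv]
  ring

/-! ### Membership in the spaces and passage to norms -/

/-- For r > 1/2 the kernel lies in L_2, so its convolution with φ is bounded. Hence the sum of the
two endpoint spaces lies in L_∞, and the L_p condition in the Besov space is automatic there. -/
theorem memLp_of_sobolevNorm_lt_top {r : ℝ} (hr : 1 / 2 < r) {α : Fin d → ℝ} {f : L1 d}
    (h : sobolevNorm r α 2 f < ∞) : MemLp f ∞ volume := by
  simp only [sobolevNorm, iInf_lt_iff] at h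
  obtain ⟨φ, ⟨-, hf⟩, -⟩ := h
  exact (memLp_congr_ae hf).2 (memLp_top_conv (memLp_bernoulliKernelMulti hr α) (Lp.memLp φ))

theorem memLp_of_besovNorm_lt_top {r : ℝ} {p q : ℝ≥0∞} {f : L1 d} (h : besovNorm r p q f < ∞) :
    MemLp f p volume := by
  by_contra hf
  rw [besovNorm, if_neg hf] at h
  exact lt_irrefl _ h

/-- A finite integral forces K to be finite at almost every t > 0, and one such t is enough. -/
theorem exists_decomposition_of_lintegral_ne_top {E : Type*} [AddCommGroup E] {N₀ N₁ : E → ℝ≥0∞}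
    {p : ℝ} (hp : 0 < p) {a : E}
    (h : ∫⁻ t in Set.Ioi (0 : ℝ), ENNReal.ofReal (t ^ (-3 : ℝ)) * kFunctional N₀ N₁ t a ^ p ≠ ∞) :
    ∃ a₀ a₁ : E, N₀ a₀ < ∞ ∧ N₁ a₁ < ∞ ∧ a = a₀ + a₁ := by
  have hm : Measurable fun t : ℝ => ENNReal.ofReal (t ^ (-3 : ℝ)) * kFunctional N₀ N₁ t a ^ p :=
    Measurable.mul (by fun_prop) ((monotone_kFunctional N₀ N₁ a).measurable.pow_const p)
  have hne : (ae (volume.restrict (Set.Ioi (0 : ℝ)))).NeBot := by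
    rw [ae_neBot, Ne, Measure.restrict_eq_zero]
    simp
  obtain ⟨t, ht, ht0⟩ := ((ae_lt_top hm h).and (ae_restrict_mem measurableSet_Ioi)).exists
  rw [Set.mem_Ioi] at ht0
  have hK : kFunctional N₀ N₁ t a < ∞ := by
    by_contra hK
    rw [not_lt_top_iff] at hK
    have h0 : ENNReal.ofReal (t ^ (-3 : ℝ)) ≠ 0 :=
      (ENNReal.ofReal_pos.2 (Real.rpow_pos_of_pos ht0 _)).ne'
    rw [hK, ENNReal.top_rpow_of_pos hp, ENNReal.mul_top h0] at ht
    exact lt_irrefl _ ht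
  obtain ⟨a₀, a₁, ha, hlt⟩ := exists_of_kFunctional_lt hK
  refine ⟨a₀, a₁, le_self_add.trans_lt hlt, ?_, ha⟩
  have h1 : ENNReal.ofReal t * N₁ a₁ < ∞ := le_add_self.trans_lt hlt
  exact ENNReal.lt_top_of_mul_ne_top_right h1.ne (ENNReal.ofReal_pos.2 ht0).ne'

theorem exists_rpow_le_mul_rpow {K : ℝ≥0∞} (hK : K ≠ ∞) {p : ℝ} (hp : 0 < p) :
    ∃ C : ℝ≥0, 0 < C ∧ ∀ x y : ℝ≥0∞, x ≤ K * y → x ^ (1 / p) ≤ C * y ^ (1 / p) := by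
  have hp' : 0 ≤ 1 / p := by positivity
  refine ⟨(K ^ (1 / p)).toNNReal + 1, by positivity, fun x y h => ?_⟩
  rw [ENNReal.coe_add, ENNReal.coe_toNNReal (ENNReal.rpow_ne_top_of_nonneg hp' hK)]
  calc x ^ (1 / p) ≤ (K * y) ^ (1 / p) := ENNReal.rpow_le_rpow h hp'
    _ = K ^ (1 / p) * y ^ (1 / p) := ENNReal.mul_rpow_of_nonneg _ _ hp'
    _ ≤ _ := mul_le_mul_left le_self_add _

end MixedSmoothness

end

theorem theorem4p5 (d : ℕ) (α : Fin d → ℝ) (p r₀ r₁ θ r : ℝ)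
    (hp : 2 < p) (hr₀ : 0 < r₀) (hr₀' : r₀ < 1 / 2) (hr₁ : r₁ = r₀ + 1 / 2)
    (hθ : θ = 2 / p) (hr : r = r₀ + 1 / p) :
    MixedSmoothness.interpolationSpace
        (MixedSmoothness.besovNorm (d := d) r₀ ∞ ∞)
        (MixedSmoothness.sobolevNorm r₁ α 2) θ p =
      MixedSmoothness.besovSpace d r (ENNReal.ofReal p) (ENNReal.ofReal p) ∧
    ∃ c C : ℝ≥0, 0 < c ∧ 0 < C ∧
      ∀ f ∈ MixedSmoothness.besovSpace d r (ENNReal.ofReal p) (ENNReal.ofReal p),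
        c * MixedSmoothness.besovNorm r (ENNReal.ofReal p) (ENNReal.ofReal p) f ≤
            MixedSmoothness.interpolationNorm
              (MixedSmoothness.besovNorm r₀ ∞ ∞)
              (MixedSmoothness.sobolevNorm r₁ α 2) θ p f ∧
          MixedSmoothness.interpolationNorm
              (MixedSmoothness.besovNorm r₀ ∞ ∞)
              (MixedSmoothness.sobolevNorm r₁ α 2) θ p f ≤
            C * MixedSmoothness.besovNorm r (ENNReal.ofReal p) (ENNReal.ofReal p) f := by
  open MixedSmoothness in
  have hp0 : 0 < p := by linarith
  have h2p : 2 ≤ ENNReal.ofReal p := by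
    rw [show (2 : ℝ≥0∞) = ENNReal.ofReal 2 by simp]
    exact ENNReal.ofReal_le_ofReal hp.le
  have hK₁ : (4 : ℝ≥0∞) ^ p * (8 * ENNReal.ofReal (2 ^ r₁) ^ (2 * d)) ≠ ∞ :=
    ENNReal.mul_ne_top (ENNReal.rpow_ne_top_of_nonneg hp0.le (by norm_num))
      (ENNReal.mul_ne_top (by norm_num) (ENNReal.pow_ne_top ENNReal.ofReal_ne_top))
  have hK₂ : (lowConst d r₀ + highConst d r₁ ^ (1 / 2 : ℝ) + 1) ^ p * ENNReal.ofReal p /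
      ENNReal.ofReal (p - 2) ≠ ∞ := by
    refine ENNReal.div_ne_top (ENNReal.mul_ne_top (ENNReal.rpow_ne_top_of_nonneg hp0.le ?_)
      ENNReal.ofReal_ne_top) (ENNReal.ofReal_pos.2 (sub_pos.2 hp)).ne'
    have := lowConst_ne_top d hr₀
    have := ENNReal.rpow_ne_top_of_nonneg (y := 1 / 2) (by norm_num)
      (highConst_ne_top d (r := r₁) (by linarith))
    finiteness
  obtain ⟨C₁, hC₁, hlow⟩ := exists_rpow_le_mul_rpow hK₁ hp0
  obtain ⟨C₂, hC₂, hupp⟩ := exists_rpow_le_mul_rpow hK₂ hp0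
  have hbesov : ∀ f : L1 d, MemLp f (ENNReal.ofReal p) volume →
      besovNorm r (ENNReal.ofReal p) (ENNReal.ofReal p) f = blockEnergy r₀ p f ^ (1 / p) :=
    fun f hf => by rw [besovNorm, if_pos hf, blockNorm_eq hp0 hr]
  have hlower : ∀ f : L1 d, MemLp f (ENNReal.ofReal p) volume →
      besovNorm r (ENNReal.ofReal p) (ENNReal.ofReal p) f ≤
        C₁ * interpolationNorm (besovNorm r₀ ∞ ∞) (sobolevNorm r₁ α 2) θ p f := fun f hf => by
    rw [hbesov f hf, interpolationNorm_eq _ _ hp0 hθ]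
    exact hlow _ _ (blockEnergy_le hp0 hr₀ hr₁ α f)
  have hupper : ∀ f : L1 d, MemLp f (ENNReal.ofReal p) volume →
      interpolationNorm (besovNorm r₀ ∞ ∞) (sobolevNorm r₁ α 2) θ p f ≤
        C₂ * besovNorm r (ENNReal.ofReal p) (ENNReal.ofReal p) f := fun f hf => by
    rw [hbesov f hf, interpolationNorm_eq _ _ hp0 hθ]
    exact hupp _ _ (lintegral_kFunctional_le hp hr₀ hr₁ α (hf.mono_exponent h2p))
  -- Both inequalities hold in [0,∞] for every f in L_p, so they yield the two inclusions as well as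
  -- the equivalence of norms.
  refine ⟨Set.Subset.antisymm ?_ ?_, C₁⁻¹, C₂, inv_pos.2 hC₁, hC₂, fun f hf => ⟨?_, ?_⟩⟩
  · rintro f ⟨⟨f₀, f₁, h0, h1, hf⟩, hN⟩
    have hfm : MemLp f (ENNReal.ofReal p) volume := by
      have h2 := ((memLp_of_besovNorm_lt_top h0).add
        (memLp_of_sobolevNorm_lt_top (by linarith) h1)).mono_exponent
          (le_top : ENNReal.ofReal p ≤ ∞)
      rw [hf]
      exact (memLp_congr_ae (Lp.coeFn_add f₀ f₁)).2 h2
    exact (hlower f hfm).trans_lt (ENNReal.mul_lt_top ENNReal.coe_lt_top hN)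
  · intro f hf
    have hN := (hupper f (memLp_of_besovNorm_lt_top hf)).trans_lt
      (ENNReal.mul_lt_top ENNReal.coe_lt_top hf)
    refine ⟨exists_decomposition_of_lintegral_ne_top hp0 fun htop => ?_, hN⟩
    rw [interpolationNorm_eq _ _ hp0 hθ, htop, ENNReal.top_rpow_of_pos (by positivity)] at hN
    exact lt_irrefl _ hN
  · rw [ENNReal.coe_inv hC₁.ne', ENNReal.inv_mul_le_iff (by exact_mod_cast hC₁.ne')
      ENNReal.coe_ne_top]
    exact hlower f (memLp_of_besovNorm_lt_top hf)
  · exact hupper f (memLp_of_besovNorm_lt_top hf)
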